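/- A set $D$ of vertices of a graph is dominating if every vertex belongs to $D$ or has a neighbor in $D$; it is a minimal dominating set if it is dominating and no proper subset of $D$ is dominating. A snowflake is the tree with 13 vertices consisting of six paths with two edges each, attached to a common central vertex. For $k\ge 0$, the star of $k$ snowflakes (without additional leaf) is the graph with $13k+1$ vertices that consists of $k$ disjoint snowflakes and a separate root vertex that is joined by an edge to one leaf of each snowflake. Let $\lambda=\sqrt[13]{95}\approx 1.4194908$ (that is, $|\lambda-1.4194908|<5\cdot10^{-8}$). 1. For every $n\ge1$, every tree with $n$ vertices has at most $2\lambda^{n-2}$ minimal dominating sets, and $2\lambda^{n-2}<0.992579\cdot\lambda^n$. 2. For every $n\ge 1$ there is a tree with $n$ vertices that has at least $0.649748\cdot\lambda^n$ minimal dominating sets. 3. For every $n$ of the form $n=13k+1$ with $k\ge0$ there is a tree with $n$ vertices, namely the star of $k$ snowflakes, that has at least $95^k$ minimal dominating sets, and $95^k>0.704477\cdot\lambda^n$. -/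

import Mathlib

namespace MDS

/-- A set of vertices is dominating if every vertex lies in it or is adjacent to one of its
elements. -/
def IsDominating {V : Type*} (G : SimpleGraph V) (D : Set V) : Prop :=
  ∀ b : V, ∃ a ∈ D, b = a ∨ G.Adj a b

/-- A minimal dominating set: a dominating set no proper subset of which is dominating. -/
def IsMinimalDominating {V : Type*} (G : SimpleGraph V) (D : Set V) : Prop :=
  IsDominating G D ∧ ∀ D' : Set V, D' ⊂ D → ¬ IsDominating G D'

/-- The number of minimal dominating sets of a graph (meant for finite vertex sets). -/
noncomputable def numMDS {V : Type*} (G : SimpleGraph V) : ℕ :=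
  {D : Set V | IsMinimalDominating G D}.ncard

/-- The thirteenth root of 95. -/
noncomputable def lam : ℝ := (95 : ℝ) ^ ((1 : ℝ) / 13)

/-- The 13 vertices of a snowflake: `none` is the centre; `some (j, false)` is the middle vertex
and `some (j, true)` the end vertex of the `j`-th arm. -/
abbrev FlakeVertex : Type := Option (Fin 6 × Bool)

/-- The snowflake: six paths with two edges each, attached to a central vertex. -/
def snowflake : SimpleGraph FlakeVertex :=
  SimpleGraph.fromRel fun u v =>
    (∃ j, u = none ∧ v = some (j, false)) ∨
    (∃ j, u = some (j, false) ∧ v = some (j, true))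

/-- The star of `k` snowflakes: `k` disjoint snowflakes and a root vertex `none`, which is joined
to one leaf of each snowflake. -/
def starOfSnowflakes (k : ℕ) : SimpleGraph (Option (Fin k × FlakeVertex)) :=
  SimpleGraph.fromRel fun x y =>
    (∃ i, x = none ∧ y = some (i, some (0, true))) ∨
    (∃ i u v, x = some (i, u) ∧ y = some (i, v) ∧ snowflake.Adj u v)

end MDS

namespace MDS

open SimpleGraph

/-- The type of the trace of a (partial) dominating set on a rooted graph, where the root may still
receive a further neighbour. The root is in the set for `good`, `self` and `lacking`: it has a
private neighbour other than itself; it only has itself as a private neighbour; it has none.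
The root is not in the set for `dominated`, `needed` and `free`: it is dominated and no vertex needs
it as a private neighbour; some vertex needs it as its private neighbour; it is not dominated. -/
inductive State
  | good | self | lacking | dominated | needed | free
  deriving DecidableEq

namespace State

instance : Fintype State where
  elems := {good, self, lacking, dominated, needed, free}
  complete x := by cases x <;> decide

/-- The state of a rooted graph after attaching a child: the first argument is the state of
the parent and the second one that of the child. -/
def attach : State → State → Option State
  | good, good | good, dominated | good, free => some good
  | self, free | lacking, free => some good
  | self, dominated => some self
  | self, good | lacking, good | lacking, dominated => some lacking
  | dominated, good | dominated, self | dominated, dominated | dominated, needed => some dominated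
  | free, good | free, self => some dominated
  | needed, dominated | needed, needed => some needed
  | free, lacking => some needed
  | free, dominated | free, needed => some free
  | _, _ => none

end State

section Rooted

variable {V : Type*} (G : SimpleGraph V) (r : V) (D : Set V)

/-- A vertex covers itself and its neighbours. -/
def Covers (a b : V) : Prop := b = a ∨ G.Adj a b

/-- `b` is covered by `a` and by no other element of `D`. -/
def IsPrivate (a b : V) : Prop := Covers G a b ∧ ∀ a' ∈ D, Covers G a' b → a' = a

theorem isMinimalDominating_iff :
    IsMinimalDominating G D ↔ IsDominating G D ∧ ∀ a ∈ D, ∃ b, IsPrivate G D a b := by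
  constructor
  · rintro ⟨h, hmin⟩
    refine ⟨h, fun a ha => ?_⟩
    have := hmin (D \ {a}) ⟨Set.sdiff_subset, fun hs => (hs ha).2 rfl⟩
    simp only [IsDominating, not_forall] at this
    obtain ⟨b, hb⟩ := this
    have key : ∀ a' ∈ D, Covers G a' b → a' = a := by
      intro a' ha' hc
      by_contra hne
      exact hb ⟨a', ⟨ha', hne⟩, hc⟩
    obtain ⟨a', ha', hc⟩ := h b
    obtain rfl := key a' ha' hc
    exact ⟨b, hc, key⟩
  · rintro ⟨h, hp⟩
    refine ⟨h, fun D' hD' hdom => ?_⟩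
    obtain ⟨a, ha, ha'⟩ := Set.exists_of_ssubset hD'
    obtain ⟨b, -, hb⟩ := hp a ha
    obtain ⟨a', h1, h2⟩ := hdom b
    exact ha' (hb a' (hD'.1 h1) h2 ▸ h1)

/-- The root has a neighbour in `D`. -/
def RootHasNeighbor : Prop := ∃ a ∈ D, G.Adj a r

/-- Every vertex other than the root is dominated. -/
def DominatesOffRoot : Prop := ∀ b, b ≠ r → ∃ a ∈ D, Covers G a b

/-- Every element of `D` other than the root has a private neighbour other than the root. -/
def PrivateOffRoot : Prop := ∀ a ∈ D, a ≠ r → ∃ b, b ≠ r ∧ IsPrivate G D a b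

/-- Every element of `D` other than the root has a private neighbour. -/
def PrivateAll : Prop := ∀ a ∈ D, a ≠ r → ∃ b, IsPrivate G D a b

/-- The root has a private neighbour other than itself. -/
def RootPrivate : Prop := ∃ b, b ≠ r ∧ IsPrivate G D r b

/-- The state as a function of the truth values of, in this order, `r ∈ D`, `RootHasNeighbor`,
`DominatesOffRoot`, `PrivateOffRoot`, `PrivateAll` and `RootPrivate`. -/
def stateOf (i c k q q' w : Bool) : Option State :=
  if k then
    if i then
      if q then (if w then some .good else if c then some .lacking else some .self) else none
    else if q then (if c then some .dominated else some .free)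
    else if q' then some .needed else none
  else none

open Classical in
/-- The state of the rooted graph with respect to `D`, if `D` can be part of a minimal dominating
set. -/
noncomputable def status : Option State :=
  stateOf (decide (r ∈ D)) (decide (RootHasNeighbor G r D)) (decide (DominatesOffRoot G r D))
    (decide (PrivateOffRoot G r D)) (decide (PrivateAll G r D)) (decide (RootPrivate G r D))

variable {G r D}

theorem PrivateOffRoot.privateAll (h : PrivateOffRoot G r D) : PrivateAll G r D :=
  fun a ha har => (h a ha har).imp fun _ hb => hb.2

theorem PrivateAll.privateOffRoot (h : PrivateAll G r D) (hr : r ∉ D)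
    (hc : ¬ RootHasNeighbor G r D) : PrivateOffRoot G r D := by
  intro a ha har
  obtain ⟨b, hb⟩ := h a ha har
  refine ⟨b, ?_, hb⟩
  rintro rfl
  rcases hb.1 with h | h
  · exact har h.symm
  · exact hc ⟨a, ha, h⟩

variable (G r D)

theorem isDominating_iff : IsDominating G D ↔
    DominatesOffRoot G r D ∧ (r ∈ D ∨ RootHasNeighbor G r D) := by
  constructor
  · refine fun h => ⟨fun b _ => h b, ?_⟩
    obtain ⟨a, ha, rfl | h⟩ := h r
    · exact .inl ha
    · exact .inr ⟨a, ha, h⟩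
  · rintro ⟨h1, h2⟩ b
    by_cases hb : b = r
    · subst hb
      rcases h2 with h | ⟨a, ha, h⟩
      · exact ⟨b, h, .inl rfl⟩
      · exact ⟨a, ha, .inr h⟩
    · exact h1 b hb

theorem privateOffRoot_iff_privateAll (hr : r ∈ D) : PrivateOffRoot G r D ↔ PrivateAll G r D := by
  refine ⟨PrivateOffRoot.privateAll, fun h a ha har => ?_⟩
  obtain ⟨b, hb⟩ := h a ha har
  refine ⟨b, ?_, hb⟩
  rintro rfl
  exact har (hb.2 b hr (.inl rfl)).symm

theorem forall_exists_isPrivate_iff : (∀ a ∈ D, ∃ b, IsPrivate G D a b) ↔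
    PrivateAll G r D ∧ (r ∈ D → RootPrivate G r D ∨ ¬ RootHasNeighbor G r D) := by
  constructor
  · refine fun h => ⟨fun a ha _ => h a ha, fun hr => ?_⟩
    obtain ⟨b, hb⟩ := h r hr
    by_cases hbr : b = r
    · subst hbr
      refine .inr fun ⟨a, ha, hab⟩ => ?_
      exact hab.ne (hb.2 a ha (.inr hab))
    · exact .inl ⟨b, hbr, hb⟩
  · rintro ⟨h1, h2⟩ a ha
    by_cases har : a = r
    · subst har
      rcases h2 ha with ⟨b, -, hb⟩ | h
      · exact ⟨b, hb⟩
      · refine ⟨a, .inl rfl, fun a' ha' hc => ?_⟩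
        rcases hc with h' | h'
        · exact h'.symm
        · exact (h ⟨a', ha', h'⟩).elim
    · exact h1 a ha har

theorem isMinimalDominating_iff_status : IsMinimalDominating G D ↔
    status G r D = some .good ∨ status G r D = some .self ∨ status G r D = some .dominated ∨
      status G r D = some .needed := by
  classical
  rw [isMinimalDominating_iff, isDominating_iff G r, forall_exists_isPrivate_iff G r, status]
  have h1 := privateOffRoot_iff_privateAll G r D
  have h2 := @PrivateOffRoot.privateAll V G r D
  have h3 := @PrivateAll.privateOffRoot V G r D
  by_cases i : r ∈ D <;> by_cases c : RootHasNeighbor G r D <;>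
    by_cases k : DominatesOffRoot G r D <;> by_cases q : PrivateOffRoot G r D <;>
    by_cases q' : PrivateAll G r D <;> by_cases w : RootPrivate G r D <;>
    simp [i, c, k, q, q', w, stateOf] at h1 h2 h3 ⊢

end Rooted

section Attach

variable {A B : Type*} (GA : SimpleGraph A) (r : A) (GB : SimpleGraph B) (s : B)

/-- The graph obtained by joining the root of one rooted graph to the root of another one. -/
def attachGraph : SimpleGraph (A ⊕ B) := (GA ⊕g GB) ⊔ edge (.inl r) (.inr s)

variable {GA r GB s}

@[simp] theorem attachGraph_adj_inl_inl {a b : A} :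
    (attachGraph GA r GB s).Adj (.inl a) (.inl b) ↔ GA.Adj a b := by
  simp [attachGraph, edge_adj]

@[simp] theorem attachGraph_adj_inr_inr {a b : B} :
    (attachGraph GA r GB s).Adj (.inr a) (.inr b) ↔ GB.Adj a b := by
  simp [attachGraph, edge_adj]

@[simp] theorem attachGraph_adj_inl_inr {a : A} {b : B} :
    (attachGraph GA r GB s).Adj (.inl a) (.inr b) ↔ a = r ∧ b = s := by
  simp [attachGraph, edge_adj]

@[simp] theorem attachGraph_adj_inr_inl {a : A} {b : B} :
    (attachGraph GA r GB s).Adj (.inr b) (.inl a) ↔ a = r ∧ b = s := by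
  rw [adj_comm, attachGraph_adj_inl_inr]

@[simp] theorem covers_attachGraph_inl_inl {a b : A} :
    Covers (attachGraph GA r GB s) (.inl a) (.inl b) ↔ Covers GA a b := by
  simp [Covers]

@[simp] theorem covers_attachGraph_inr_inr {a b : B} :
    Covers (attachGraph GA r GB s) (.inr a) (.inr b) ↔ Covers GB a b := by
  simp [Covers]

@[simp] theorem covers_attachGraph_inl_inr {a : A} {b : B} :
    Covers (attachGraph GA r GB s) (.inl a) (.inr b) ↔ a = r ∧ b = s := by
  simp [Covers]

@[simp] theorem covers_attachGraph_inr_inl {a : A} {b : B} :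
    Covers (attachGraph GA r GB s) (.inr b) (.inl a) ↔ a = r ∧ b = s := by
  simp [Covers]

variable {D : Set (A ⊕ B)}

theorem isPrivate_attachGraph_inl_inl {a b : A} :
    IsPrivate (attachGraph GA r GB s) D (.inl a) (.inl b) ↔
      IsPrivate GA (Sum.inl ⁻¹' D) a b ∧ (b = r → s ∉ Sum.inr ⁻¹' D) := by
  simp only [IsPrivate, Sum.forall, covers_attachGraph_inl_inl, covers_attachGraph_inr_inl,
    Sum.inl.injEq, reduceCtorEq, Set.mem_preimage]
  grind

theorem isPrivate_attachGraph_inr_inr {a b : B} :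
    IsPrivate (attachGraph GA r GB s) D (.inr a) (.inr b) ↔
      IsPrivate GB (Sum.inr ⁻¹' D) a b ∧ (b = s → r ∉ Sum.inl ⁻¹' D) := by
  simp only [IsPrivate, Sum.forall, covers_attachGraph_inl_inr, covers_attachGraph_inr_inr,
    Sum.inr.injEq, reduceCtorEq, Set.mem_preimage]
  grind

theorem isPrivate_attachGraph_inl_inr {a : A} {b : B} :
    IsPrivate (attachGraph GA r GB s) D (.inl a) (.inr b) ↔
      a = r ∧ b = s ∧ s ∉ Sum.inr ⁻¹' D ∧ ¬ RootHasNeighbor GB s (Sum.inr ⁻¹' D) := by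
  simp only [IsPrivate, Sum.forall, covers_attachGraph_inl_inr, covers_attachGraph_inr_inr,
    Sum.inl.injEq, reduceCtorEq, Set.mem_preimage, RootHasNeighbor]
  simp only [Covers]
  grind

theorem isPrivate_attachGraph_inr_inl {a : A} {b : B} :
    IsPrivate (attachGraph GA r GB s) D (.inr b) (.inl a) ↔
      a = r ∧ b = s ∧ r ∉ Sum.inl ⁻¹' D ∧ ¬ RootHasNeighbor GA r (Sum.inl ⁻¹' D) := by
  simp only [IsPrivate, Sum.forall, covers_attachGraph_inl_inl, covers_attachGraph_inr_inl,
    Sum.inr.injEq, reduceCtorEq, Set.mem_preimage, RootHasNeighbor]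
  simp only [Covers]
  grind

theorem rootHasNeighbor_attachGraph :
    RootHasNeighbor (attachGraph GA r GB s) (.inl r) D ↔
      RootHasNeighbor GA r (Sum.inl ⁻¹' D) ∨ s ∈ Sum.inr ⁻¹' D := by
  simp [RootHasNeighbor, Sum.exists]

theorem dominatesOffRoot_attachGraph :
    DominatesOffRoot (attachGraph GA r GB s) (.inl r) D ↔
      DominatesOffRoot GA r (Sum.inl ⁻¹' D) ∧ DominatesOffRoot GB s (Sum.inr ⁻¹' D) ∧
      (s ∈ Sum.inr ⁻¹' D ∨ RootHasNeighbor GB s (Sum.inr ⁻¹' D) ∨ r ∈ Sum.inl ⁻¹' D) := by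
  have hA : (∀ a, Sum.inl a ≠ (Sum.inl r : A ⊕ B) →
      ∃ a' ∈ D, Covers (attachGraph GA r GB s) a' (.inl a)) ↔
      DominatesOffRoot GA r (Sum.inl ⁻¹' D) := by
    refine forall_congr' fun a => ?_
    simp only [Sum.exists, ne_eq, Sum.inl.injEq, covers_attachGraph_inl_inl,
      covers_attachGraph_inr_inl, Set.mem_preimage]
    grind
  have hB : (∀ b, Sum.inr b ≠ (Sum.inl r : A ⊕ B) →
      ∃ a' ∈ D, Covers (attachGraph GA r GB s) a' (.inr b)) ↔
      ∀ b, (b = s ∧ r ∈ Sum.inl ⁻¹' D) ∨ ∃ a ∈ Sum.inr ⁻¹' D, Covers GB a b := by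
    refine forall_congr' fun b => ?_
    simp only [Sum.exists, ne_eq, reduceCtorEq, not_false_eq_true, forall_const,
      covers_attachGraph_inl_inr, covers_attachGraph_inr_inr, Set.mem_preimage]
    grind
  have hsplit : DominatesOffRoot (attachGraph GA r GB s) (.inl r) D ↔ _ ∧ _ := Sum.forall
  rw [hsplit, hA, hB]
  refine and_congr_right fun _ => ?_
  have key := isDominating_iff GB s (Sum.inr ⁻¹' D)
  by_cases hr : r ∈ Sum.inl ⁻¹' D
  · simp only [hr, and_true, or_true]
    exact forall_congr' fun b => or_iff_not_imp_left
  · simp only [hr, and_false, false_or, or_false]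
    exact key

theorem rootPrivate_attachGraph :
    RootPrivate (attachGraph GA r GB s) (.inl r) D ↔ RootPrivate GA r (Sum.inl ⁻¹' D) ∨
      (s ∉ Sum.inr ⁻¹' D ∧ ¬ RootHasNeighbor GB s (Sum.inr ⁻¹' D)) := by
  simp only [RootPrivate, Sum.exists, ne_eq, Sum.inl.injEq, reduceCtorEq,
    isPrivate_attachGraph_inl_inl, isPrivate_attachGraph_inl_inr]
  grind

theorem privateOffRoot_attachGraph :
    PrivateOffRoot (attachGraph GA r GB s) (.inl r) D ↔
      PrivateOffRoot GA r (Sum.inl ⁻¹' D) ∧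
      (r ∈ Sum.inl ⁻¹' D → PrivateOffRoot GB s (Sum.inr ⁻¹' D)) ∧
      (r ∉ Sum.inl ⁻¹' D → PrivateAll GB s (Sum.inr ⁻¹' D)) ∧
      (s ∈ Sum.inr ⁻¹' D → RootPrivate GB s (Sum.inr ⁻¹' D) ∨
        (¬ RootHasNeighbor GB s (Sum.inr ⁻¹' D) ∧ r ∉ Sum.inl ⁻¹' D)) := by
  have key := forall_exists_isPrivate_iff GB s (Sum.inr ⁻¹' D)
  have hA : (∀ a, Sum.inl a ∈ D → Sum.inl a ≠ (Sum.inl r : A ⊕ B) →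
      ∃ b, b ≠ Sum.inl r ∧ IsPrivate (attachGraph GA r GB s) D (.inl a) b) ↔
      PrivateOffRoot GA r (Sum.inl ⁻¹' D) := by
    simp only [PrivateOffRoot, Sum.exists, ne_eq, Sum.inl.injEq, reduceCtorEq,
      isPrivate_attachGraph_inl_inl, isPrivate_attachGraph_inl_inr, Set.mem_preimage]
    grind
  have hB : (∀ a, Sum.inr a ∈ D → Sum.inr a ≠ (Sum.inl r : A ⊕ B) →
      ∃ b, b ≠ Sum.inl r ∧ IsPrivate (attachGraph GA r GB s) D (.inr a) b) ↔
      ∀ a ∈ Sum.inr ⁻¹' D, ∃ b, IsPrivate GB (Sum.inr ⁻¹' D) a b ∧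
        (b = s → r ∉ Sum.inl ⁻¹' D) := by
    simp only [Sum.exists, ne_eq, Sum.inl.injEq, reduceCtorEq,
      isPrivate_attachGraph_inr_inl, isPrivate_attachGraph_inr_inr, Set.mem_preimage]
    grind
  have hsplit : PrivateOffRoot (attachGraph GA r GB s) (.inl r) D ↔ _ ∧ _ := Sum.forall
  rw [hsplit, hA, hB]
  by_cases hr : r ∈ Sum.inl ⁻¹' D
  · simp only [hr, not_true_eq_false, imp_false, forall_const, IsEmpty.forall_iff, and_false,
      or_false, true_and]
    refine and_congr_right fun _ => ?_
    clear hA hB key hsplit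
    simp only [PrivateOffRoot, RootPrivate]
    constructor
    · refine fun h => ⟨fun a ha _ => ?_, fun hs => ?_⟩
      · obtain ⟨b, h1, h2⟩ := h a ha
        exact ⟨b, h2, h1⟩
      · obtain ⟨b, h1, h2⟩ := h s hs
        exact ⟨b, h2, h1⟩
    · rintro ⟨h1, h2⟩ a ha
      by_cases has : a = s
      · subst has
        obtain ⟨b, h3, h4⟩ := h2 ha
        exact ⟨b, h4, h3⟩
      · obtain ⟨b, h3, h4⟩ := h1 a ha has
        exact ⟨b, h4, h3⟩
  · simp only [hr, not_false_eq_true, implies_true, and_true, IsEmpty.forall_iff, forall_const,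
      true_and, key]

theorem privateAll_attachGraph (hr : r ∉ Sum.inl ⁻¹' D) :
    PrivateAll (attachGraph GA r GB s) (.inl r) D ↔
      (PrivateOffRoot GA r (Sum.inl ⁻¹' D) ∨
        (PrivateAll GA r (Sum.inl ⁻¹' D) ∧ s ∉ Sum.inr ⁻¹' D)) ∧
      PrivateAll GB s (Sum.inr ⁻¹' D) ∧
      (s ∈ Sum.inr ⁻¹' D → RootPrivate GB s (Sum.inr ⁻¹' D) ∨
        ¬ RootHasNeighbor GB s (Sum.inr ⁻¹' D) ∨ ¬ RootHasNeighbor GA r (Sum.inl ⁻¹' D)) := by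
  have key := forall_exists_isPrivate_iff GB s (Sum.inr ⁻¹' D)
  have hA : (∀ a, Sum.inl a ∈ D → Sum.inl a ≠ (Sum.inl r : A ⊕ B) →
      ∃ b, IsPrivate (attachGraph GA r GB s) D (.inl a) b) ↔
      (PrivateOffRoot GA r (Sum.inl ⁻¹' D) ∨
        (PrivateAll GA r (Sum.inl ⁻¹' D) ∧ s ∉ Sum.inr ⁻¹' D)) := by
    by_cases hs : s ∈ Sum.inr ⁻¹' D
    · simp only [PrivateOffRoot, PrivateAll, Sum.exists, ne_eq, Sum.inl.injEq,
        isPrivate_attachGraph_inl_inl, isPrivate_attachGraph_inl_inr, Set.mem_preimage] at hs ⊢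
      grind
    · rw [and_iff_left hs, or_iff_right_of_imp PrivateOffRoot.privateAll]
      simp only [PrivateAll, Sum.exists, ne_eq, Sum.inl.injEq,
        isPrivate_attachGraph_inl_inl, isPrivate_attachGraph_inl_inr, Set.mem_preimage] at hs ⊢
      grind
  have hB : (∀ a, Sum.inr a ∈ D → Sum.inr a ≠ (Sum.inl r : A ⊕ B) →
      ∃ b, IsPrivate (attachGraph GA r GB s) D (.inr a) b) ↔
      ∀ a ∈ Sum.inr ⁻¹' D, (∃ b, IsPrivate GB (Sum.inr ⁻¹' D) a b) ∨
        (a = s ∧ ¬ RootHasNeighbor GA r (Sum.inl ⁻¹' D)) := by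
    simp only [Sum.exists, ne_eq, reduceCtorEq,
      isPrivate_attachGraph_inr_inl, isPrivate_attachGraph_inr_inr, Set.mem_preimage] at hr ⊢
    grind
  have hsplit : PrivateAll (attachGraph GA r GB s) (.inl r) D ↔ _ ∧ _ := Sum.forall
  rw [hsplit, hA, hB]
  refine and_congr_right fun _ => ?_
  by_cases hc : RootHasNeighbor GA r (Sum.inl ⁻¹' D)
  · simp only [hc, not_true_eq_false, and_false, or_false, key]
  · simp only [hc, not_false_eq_true, and_true, or_true, implies_true]
    simp only [PrivateAll]
    grind

theorem stateOf_attach (i c k q q' w i₂ c₂ k₂ q₂ q₂' w₂ Q' : Bool) (h : q → q')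
    (h' : q' → i = false → c = false → q) (h₂ : q₂ → q₂')
    (h₂' : q₂' → i₂ = false → c₂ = false → q₂)
    (hi₂ : i₂ = true → q₂' = q₂)
    (hQ' : i = false → Q' = ((q || (q' && !i₂)) && q₂' && (!i₂ || (w₂ || !c₂ || !c)))) :
    stateOf i (c || i₂) (k && k₂ && (i₂ || c₂ || i))
      (q && (!i || q₂) && (i || q₂') && (!i₂ || (w₂ || (!c₂ && !i)))) Q' (w || (!i₂ && !c₂)) =
    (stateOf i c k q q' w).bind fun σ => (stateOf i₂ c₂ k₂ q₂ q₂' w₂).bind σ.attach := by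
  cases i <;> simp only [forall_const, reduceCtorEq, IsEmpty.forall_iff] at hQ' <;>
    subst_vars <;> revert h h' h₂ h₂' hi₂
  · revert c k q q' w i₂ c₂ k₂ q₂ q₂' w₂
    decide
  · revert c k q q' w i₂ c₂ k₂ q₂ q₂' w₂ Q'
    decide

theorem status_attachGraph : status (attachGraph GA r GB s) (.inl r) D =
    (status GA r (Sum.inl ⁻¹' D)).bind fun σ => (status GB s (Sum.inr ⁻¹' D)).bind σ.attach := by
  classical
  simp only [status]
  rw [← stateOf_attach]
  rotate_left
  · exact decide (PrivateAll (attachGraph GA r GB s) (Sum.inl r) D)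
  · simpa using PrivateOffRoot.privateAll
  · simpa only [decide_eq_true_eq, decide_eq_false_iff_not] using PrivateAll.privateOffRoot
  · simpa using PrivateOffRoot.privateAll
  · simpa only [decide_eq_true_eq, decide_eq_false_iff_not] using PrivateAll.privateOffRoot
  · intro h
    simpa using (privateOffRoot_iff_privateAll GB s (Sum.inr ⁻¹' D) (by simpa using h)).symm
  · intro h
    have h' : r ∉ Sum.inl ⁻¹' D := by simpa using h
    rw [Bool.eq_iff_iff]
    simp only [decide_eq_true_eq, privateAll_attachGraph h', Bool.and_eq_true, Bool.or_eq_true,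
      Bool.not_eq_true', decide_eq_false_iff_not]
    tauto
  · congr 1 <;> rw [Bool.eq_iff_iff]
    · simp [rootHasNeighbor_attachGraph]
    · simp only [decide_eq_true_eq, dominatesOffRoot_attachGraph, Bool.and_eq_true,
        Bool.or_eq_true]
      tauto
    · simp only [decide_eq_true_eq, privateOffRoot_attachGraph, Bool.and_eq_true, Bool.or_eq_true,
        Bool.not_eq_true', decide_eq_false_iff_not]
      tauto
    · simp only [decide_eq_true_eq, rootPrivate_attachGraph, Bool.and_eq_true, Bool.or_eq_true,
        Bool.not_eq_true', decide_eq_false_iff_not]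

end Attach

end MDS

namespace MDS

open SimpleGraph

/-- Six numbers, one for every state of a rooted graph. -/
@[ext] structure Vec (R : Type*) where
  g : R
  s : R
  l : R
  d : R
  p : R
  f : R

namespace Vec

variable {R : Type*} [CommSemiring R]

/-- The bilinear operation by which the numbers for a parent and a child determine those for
the graph in which the child is attached to the parent. -/
def mul (v w : Vec R) : Vec R where
  g := v.g * (w.g + w.d + w.f) + (v.s + v.l) * w.f
  s := v.s * w.d
  l := v.s * w.g + v.l * (w.g + w.d)
  d := v.d * (w.g + w.s + w.d + w.p) + v.f * (w.g + w.s)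
  p := v.p * (w.d + w.p) + v.f * w.l
  f := v.f * (w.d + w.p)

/-- The vector of a single vertex. -/
def single : Vec R := ⟨0, 1, 0, 0, 0, 1⟩

/-- The number of minimal dominating sets. -/
def total (v : Vec R) : R := v.g + v.s + v.d + v.p

end Vec

section Count

variable {V : Type*} (G : SimpleGraph V) (r : V)

/-- The number of sets of vertices for which the rooted graph is in a given state. -/
noncomputable def count (σ : State) : ℕ := {D : Set V | status G r D = some σ}.ncard

/-- The numbers of sets of vertices for the six states. -/
noncomputable def counts : Vec ℕ :=
  ⟨count G r .good, count G r .self, count G r .lacking, count G r .dominated, count G r .needed,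
    count G r .free⟩

theorem numMDS_eq_total [Finite V] : numMDS G = (counts G r).total := by
  have h : {D : Set V | IsMinimalDominating G D} = {D | status G r D = some .good} ∪
      ({D | status G r D = some .self} ∪ ({D | status G r D = some .dominated} ∪
        {D | status G r D = some .needed})) := by
    ext D
    simp [isMinimalDominating_iff_status G r D]
  have disj : ∀ {σ τ : State}, σ ≠ τ →
      Disjoint {D | status G r D = some σ} {D | status G r D = some τ} := fun hne =>
    Set.disjoint_left.2 fun D h1 h2 => hne (Option.some_injective _ (h1.symm.trans h2))
  rw [numMDS, h, Set.ncard_union_eq, Set.ncard_union_eq, Set.ncard_union_eq]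
  · simp [Vec.total, counts, count, add_assoc]
  · exact disj (by decide)
  · exact Set.disjoint_union_right.2 ⟨disj (by decide), disj (by decide)⟩
  · exact Set.disjoint_union_right.2
      ⟨disj (by decide), Set.disjoint_union_right.2 ⟨disj (by decide), disj (by decide)⟩⟩

variable {G} {V' : Type*} {G' : SimpleGraph V'}

theorem status_iso (e : G ≃g G') (D : Set V') : status G' (e r) D = status G r (e ⁻¹' D) := by
  have hcov : ∀ a b, Covers G' (e a) (e b) ↔ Covers G a b := fun a b => by
    simp [Covers, e.map_adj_iff]
  have hpriv : ∀ a b, IsPrivate G' D (e a) (e b) ↔ IsPrivate G (e ⁻¹' D) a b := fun a b => by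
    simp [IsPrivate, hcov, e.surjective.forall]
  have h1 : RootHasNeighbor G' (e r) D ↔ RootHasNeighbor G r (e ⁻¹' D) := by
    simp [RootHasNeighbor, e.surjective.exists, e.map_adj_iff]
  have h2 : DominatesOffRoot G' (e r) D ↔ DominatesOffRoot G r (e ⁻¹' D) := by
    simp [DominatesOffRoot, e.surjective.exists, e.surjective.forall, hcov]
  have h3 : PrivateOffRoot G' (e r) D ↔ PrivateOffRoot G r (e ⁻¹' D) := by
    simp [PrivateOffRoot, e.surjective.exists, e.surjective.forall, hpriv]
  have h4 : PrivateAll G' (e r) D ↔ PrivateAll G r (e ⁻¹' D) := by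
    simp [PrivateAll, e.surjective.exists, e.surjective.forall, hpriv]
  have h5 : RootPrivate G' (e r) D ↔ RootPrivate G r (e ⁻¹' D) := by
    simp [RootPrivate, e.surjective.exists, hpriv]
  simp only [status]
  congr 1 <;> simp only [decide_eq_decide, *]

theorem count_iso (e : G ≃g G') (σ : State) : count G' (e r) σ = count G r σ := by
  have hb : Function.Bijective fun D : Set V' => e ⁻¹' D :=
    ⟨Set.preimage_injective.2 e.surjective, Set.preimage_surjective.2 e.injective⟩
  rw [count, count]
  refine Set.ncard_congr (fun D _ => e ⁻¹' D) (fun D hD => ?_) (fun D D' _ _ h => hb.1 h)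
    fun D hD => ?_
  · simpa [status_iso] using hD
  · obtain ⟨D', rfl⟩ := hb.2 D
    exact ⟨D', by simpa [status_iso] using hD, rfl⟩

theorem counts_iso (e : G ≃g G') : counts G' (e r) = counts G r := by
  simp [counts, count_iso]

theorem numMDS_iso (e : G ≃g G') : numMDS G' = numMDS G := by
  have h : ∀ D : Set V', IsMinimalDominating G' D ↔ IsMinimalDominating G (e ⁻¹' D) := fun D => by
    simp [isMinimalDominating_iff, IsDominating, IsPrivate, Covers, e.surjective.forall,
      e.surjective.exists, e.map_adj_iff]
  have hb : Function.Bijective fun D : Set V' => e ⁻¹' D :=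
    ⟨Set.preimage_injective.2 e.surjective, Set.preimage_surjective.2 e.injective⟩
  refine Set.ncard_congr (fun D _ => e ⁻¹' D) (fun D hD => (h D).1 hD) (fun D D' _ _ h => hb.1 h)
    fun D hD => ?_
  obtain ⟨D', rfl⟩ := hb.2 D
  exact ⟨D', (h D').2 hD, rfl⟩

end Count

section Attach

variable {A B : Type*} [Finite A] [Finite B] (GA : SimpleGraph A) (r : A) (GB : SimpleGraph B)
  (s : B)

theorem count_attachGraph (σ : State) : count (attachGraph GA r GB s) (.inl r) σ =
    ∑ τ : State, ∑ τ' : State,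
      if τ.attach τ' = some σ then count GA r τ * count GB s τ' else 0 := by
  classical
  cases nonempty_fintype A
  cases nonempty_fintype B
  have hmul : ∀ τ τ', count GA r τ * count GB s τ' =
      {x : Set A × Set B | status GA r x.1 = some τ ∧ status GB s x.2 = some τ'}.ncard := by
    intro τ τ'
    rw [count, count, ← Set.ncard_prod]
    rfl
  have hsum : count (attachGraph GA r GB s) (.inl r) σ =
      {x : Set A × Set B | ((status GA r x.1).bind fun τ => (status GB s x.2).bind τ.attach) =
        some σ}.ncard := by
    rw [count]
    refine Set.ncard_congr (fun D _ => (Sum.inl ⁻¹' D, Sum.inr ⁻¹' D)) (fun D hD => ?_)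
      (fun D D' _ _ h => ?_) fun x hx => ?_
    · simpa [status_attachGraph] using hD
    · simp only [Prod.mk.injEq] at h
      ext (a | b)
      · exact Set.ext_iff.1 h.1 a
      · exact Set.ext_iff.1 h.2 b
    · refine ⟨Sum.inl '' x.1 ∪ Sum.inr '' x.2, ?_, ?_⟩
      · simpa [status_attachGraph, Set.preimage_image_eq _ Sum.inl_injective,
          Set.preimage_image_eq _ Sum.inr_injective] using hx
      · simp [Set.preimage_image_eq _ Sum.inl_injective,
          Set.preimage_image_eq _ Sum.inr_injective]
  have hind : ∀ (q : Set A × Set B → Prop) [DecidablePred q],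
      {x | q x}.ncard = ∑ x, if q x then 1 else 0 := fun q _ => by
    rw [Set.ncard_eq_toFinset_card', Finset.sum_boole, Nat.cast_id]
    congr 1
    ext x
    simp
  rw [hsum]
  simp only [hmul, hind]
  have hswap : ∀ τ τ' : State, (if τ.attach τ' = some σ then ∑ x : Set A × Set B,
      (if status GA r x.1 = some τ ∧ status GB s x.2 = some τ' then 1 else 0) else 0) =
      ∑ x : Set A × Set B, if τ.attach τ' = some σ ∧ status GA r x.1 = some τ ∧
        status GB s x.2 = some τ' then 1 else 0 := by
    intro τ τ'
    by_cases h : τ.attach τ' = some σ <;> simp [h]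
  simp only [hswap]
  rw [Finset.sum_congr rfl fun τ _ => Finset.sum_comm, Finset.sum_comm]
  refine Finset.sum_congr rfl fun x _ => ?_
  rcases status GA r x.1 with - | τ
  · simp
  rcases status GB s x.2 with - | τ'
  · simp
  simp only [Option.bind_some, Option.some.injEq]
  rw [Finset.sum_eq_single τ, Finset.sum_eq_single τ']
  · simp
  · intro _ _ h
    simp [h.symm]
  · simp
  · intro _ _ h
    simp [h.symm]
  · simp

theorem sum_state (F : State → ℕ) : ∑ τ, F τ =
    F .good + (F .self + (F .lacking + (F .dominated + (F .needed + F .free)))) := rfl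

theorem counts_attachGraph :
    counts (attachGraph GA r GB s) (.inl r) = (counts GA r).mul (counts GB s) := by
  ext <;> simp only [counts, count_attachGraph, Vec.mul, sum_state, State.attach,
    Option.some.injEq, reduceCtorEq, if_true, if_false, add_zero, zero_add] <;> ring

end Attach

theorem counts_of_subsingleton {V : Type*} [Subsingleton V] (G : SimpleGraph V) (r : V) :
    counts G r = Vec.single := by
  have hu : ∀ x, x = r := fun x => Subsingleton.elim x r
  have hadj : ∀ a b, ¬ G.Adj a b := fun a b h => h.ne (Subsingleton.elim a b)
  have h1 : ∀ D, ¬ RootHasNeighbor G r D := fun D ⟨a, _, h⟩ => hadj _ _ h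
  have h2 : ∀ D, DominatesOffRoot G r D := fun D b hb => (hb (hu b)).elim
  have h3 : ∀ D, PrivateOffRoot G r D := fun D a _ hb => (hb (hu a)).elim
  have h4 : ∀ D, ¬ RootPrivate G r D := fun D ⟨b, hb, _⟩ => hb (hu b)
  have hs : ∀ D, status G r D = open Classical in if r ∈ D then some .self else some .free := by
    intro D
    by_cases h : r ∈ D <;> simp [status, stateOf, h1, h2, h3, h4, h]
  have hin : {D : Set V | r ∈ D} = {Set.univ} := by
    ext D
    refine ⟨fun h => Set.eq_univ_of_forall fun x => hu x ▸ h, ?_⟩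
    rintro rfl
    trivial
  have hout : {D : Set V | r ∉ D} = {∅} := by
    ext D
    refine ⟨fun h => Set.eq_empty_of_forall_notMem fun x hx => h (hu x ▸ hx), ?_⟩
    rintro rfl
    exact Set.notMem_empty r
  have hif : ∀ (σ : State) (D : Set V), ((open Classical in if r ∈ D then some State.self
      else some State.free) = some σ) ↔ (r ∈ D ∧ .self = σ) ∨ (r ∉ D ∧ .free = σ) := by
    intro σ D
    by_cases h : r ∈ D <;> simp [h]
  ext <;> simp [counts, count, hs, hif, Vec.single, hin, hout]

end MDS

namespace MDS

open SimpleGraph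

/-! ### Growth constant -/

theorem lam_pos : 0 < lam := Real.rpow_pos_of_pos (by norm_num) _

theorem lam_pow_thirteen : lam ^ 13 = 95 := by
  rw [lam, ← Real.rpow_natCast, ← Real.rpow_mul (by norm_num)]
  norm_num

/-- Lower bounds for the powers `10 ^ 15 * lam ^ e`, where `e < 13`. -/
def lamPowTable : List ℕ := [
  1000000000000000, 1419490809476891, 2014954158189360, 2860208909067043, 4060040259604593,
  5763189834614892, 8180795003506485, 11612563321691928, 16483926909610133, 23398782752280400,
  33214357069808429, 47147474603276876, 66925406889396670]

/-- A lower bound for `10 ^ 15 * lam ^ e`. -/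
def lamPowLower (e : ℕ) : ℕ := 95 ^ (e / 13) * lamPowTable.getD (e % 13) 0

theorem lamPowTable_le (e : ℕ) (he : e < 13) :
    (lamPowTable.getD e 0 : ℝ) ≤ 10 ^ 15 * lam ^ e := by
  have key : ∀ e < 13, lamPowTable.getD e 0 ^ 13 ≤ (10 ^ 15) ^ 13 * 95 ^ e := by decide +kernel
  have h : (lamPowTable.getD e 0 : ℝ) ^ 13 ≤ (10 ^ 15 * lam ^ e) ^ 13 := by
    rw [mul_pow, ← pow_mul lam, mul_comm e 13, pow_mul lam, lam_pow_thirteen]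
    exact_mod_cast key e he
  exact le_of_pow_le_pow_left₀ (by norm_num) (by have := lam_pos; positivity) h

theorem lamPowLower_le (e : ℕ) : (lamPowLower e : ℝ) ≤ 10 ^ 15 * lam ^ e := by
  have h := lamPowTable_le (e % 13) (Nat.mod_lt _ (by norm_num))
  have h2 : lam ^ e = 95 ^ (e / 13) * lam ^ (e % 13) := by
    rw [← lam_pow_thirteen, ← pow_mul, ← pow_add, Nat.div_add_mod]
  rw [lamPowLower, h2]
  push_cast
  calc _ ≤ (95 : ℝ) ^ (e / 13) * (10 ^ 15 * lam ^ (e % 13)) := by gcongr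
    _ = _ := by ring

/-! ### Linear functionals -/

namespace Vec

variable {R : Type*} [CommSemiring R]

/-- The vector with all entries multiplied by a scalar. -/
def smul (c : R) (v : Vec R) : Vec R := ⟨c * v.g, c * v.s, c * v.l, c * v.d, c * v.p, c * v.f⟩

/-- The entrywise sum. -/
def add (v w : Vec R) : Vec R :=
  ⟨v.g + w.g, v.s + w.s, v.l + w.l, v.d + w.d, v.p + w.p, v.f + w.f⟩

/-- The standard bilinear form. -/
def dot (y v : Vec R) : R :=
  y.g * v.g + y.s * v.s + y.l * v.l + y.d * v.d + y.p * v.p + y.f * v.f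

/-- A vector of natural numbers as a vector of reals. -/
def toReal (v : Vec ℕ) : Vec ℝ := ⟨v.g, v.s, v.l, v.d, v.p, v.f⟩

theorem dot_smul (y v : Vec R) (c : R) : y.dot (v.smul c) = c * y.dot v := by
  simp only [dot, smul]; ring

theorem dot_add (y v w : Vec R) : y.dot (v.add w) = y.dot v + y.dot w := by
  simp only [dot, add]; ring

theorem smul_mul_smul (a b : R) (v w : Vec R) : (v.smul a).mul (w.smul b) = (v.mul w).smul (a * b) := by
  ext <;> simp only [mul, smul] <;> ring

theorem toReal_mul (v w : Vec ℕ) : (v.mul w).toReal = v.toReal.mul w.toReal := by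
  ext <;> simp [toReal, mul]

theorem toReal_add (v w : Vec ℕ) : (v.add w).toReal = v.toReal.add w.toReal := by
  ext <;> simp [toReal, add]

theorem toReal_smul (c : ℕ) (v : Vec ℕ) : (v.smul c).toReal = v.toReal.smul (c : ℝ) := by
  ext <;> simp [toReal, smul]

/-- Vectors with non-negative entries. -/
def Nonneg (v : Vec ℝ) : Prop :=
  0 ≤ v.g ∧ 0 ≤ v.s ∧ 0 ≤ v.l ∧ 0 ≤ v.d ∧ 0 ≤ v.p ∧ 0 ≤ v.f

theorem nonneg_toReal (v : Vec ℕ) : v.toReal.Nonneg := by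
  simp [Nonneg, toReal]

theorem Nonneg.smul {v : Vec ℝ} (hv : v.Nonneg) {c : ℝ} (hc : 0 ≤ c) : (v.smul c).Nonneg := by
  obtain ⟨h1, h2, h3, h4, h5, h6⟩ := hv
  refine ⟨?_, ?_, ?_, ?_, ?_, ?_⟩ <;> simp only [Vec.smul] <;> positivity

/-- The functionals that are compatible with the order in which the states are preferable to each
other. -/
def Mono (y : Vec ℝ) : Prop :=
  y.s ≤ y.g ∧ y.l ≤ y.s ∧ 0 ≤ y.l ∧ y.p ≤ y.d ∧ 0 ≤ y.p ∧ 0 ≤ y.f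

/-- The functional `w ↦ y.dot (v.mul w)`. -/
def pullRight (y v : Vec ℝ) : Vec ℝ where
  g := y.g * v.g + y.l * (v.s + v.l) + y.d * (v.d + v.f)
  s := y.d * (v.d + v.f)
  l := y.p * v.f
  d := y.g * v.g + y.s * v.s + y.l * v.l + y.d * v.d + y.p * v.p + y.f * v.f
  p := y.d * v.d + y.p * v.p + y.f * v.f
  f := y.g * (v.g + v.s + v.l)

/-- The functional `v ↦ y.dot (v.mul w)`. -/
def pullLeft (y w : Vec ℝ) : Vec ℝ where
  g := y.g * (w.g + w.d + w.f)
  s := y.g * w.f + y.s * w.d + y.l * w.g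
  l := y.g * w.f + y.l * (w.g + w.d)
  d := y.d * (w.g + w.s + w.d + w.p)
  p := y.p * (w.d + w.p)
  f := y.d * (w.g + w.s) + y.p * w.l + y.f * (w.d + w.p)

theorem dot_pullRight (y v w : Vec ℝ) : (y.pullRight v).dot w = y.dot (v.mul w) := by
  simp only [dot, pullRight, mul]; ring

theorem dot_pullLeft (y v w : Vec ℝ) : (y.pullLeft w).dot v = y.dot (v.mul w) := by
  simp only [dot, pullLeft, mul]; ring

theorem Mono.pullRight {y v : Vec ℝ} (hy : y.Mono) (hv : v.Nonneg) : (y.pullRight v).Mono := by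
  obtain ⟨a1, a2, a3, a4, a5, a6⟩ := hy
  obtain ⟨b1, b2, b3, b4, b5, b6⟩ := hv
  have c2 : 0 ≤ y.s := a3.trans a2
  have c1 : 0 ≤ y.g := c2.trans a1
  have c4 : 0 ≤ y.d := a5.trans a4
  simp only [Mono, Vec.pullRight]
  refine ⟨?_, ?_, by positivity, ?_, by positivity, by positivity⟩
  · have : 0 ≤ y.g * v.g + y.l * (v.s + v.l) := by positivity
    linarith
  · have := mul_le_mul_of_nonneg_right a4 b6
    have : 0 ≤ y.d * v.d := by positivity
    linarith
  · have : 0 ≤ y.g * v.g + y.s * v.s + y.l * v.l := by positivity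
    linarith

theorem Mono.pullLeft {y w : Vec ℝ} (hy : y.Mono) (hw : w.Nonneg) : (y.pullLeft w).Mono := by
  obtain ⟨a1, a2, a3, a4, a5, a6⟩ := hy
  obtain ⟨b1, b2, b3, b4, b5, b6⟩ := hw
  have c2 : 0 ≤ y.s := a3.trans a2
  have c1 : 0 ≤ y.g := c2.trans a1
  have c4 : 0 ≤ y.d := a5.trans a4
  simp only [Mono, Vec.pullLeft]
  refine ⟨?_, ?_, by positivity, ?_, by positivity, by positivity⟩
  · have h1 := mul_le_mul_of_nonneg_right a1 b4
    have h2 := mul_le_mul_of_nonneg_right (a2.trans a1) b1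
    linarith
  · have h1 := mul_le_mul_of_nonneg_right a2 b4
    linarith
  · have h1 := mul_le_mul_of_nonneg_right a4 (add_nonneg b4 b5)
    have : 0 ≤ y.d * (w.g + w.s) := by positivity
    linarith

/-- `v` is at most `w` with respect to all functionals that satisfy `Mono`. -/
def leCum (v w : Vec ℕ) : Bool :=
  Nat.ble v.g w.g && Nat.ble (v.g + v.s) (w.g + w.s) &&
    Nat.ble (v.g + v.s + v.l) (w.g + w.s + w.l) && Nat.ble v.d w.d &&
    Nat.ble (v.d + v.p) (w.d + w.p) && Nat.ble v.f w.f

theorem Mono.dot_le_dot {y : Vec ℝ} (hy : y.Mono) {v w : Vec ℕ} (h : leCum v w = true) :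
    y.dot v.toReal ≤ y.dot w.toReal := by
  obtain ⟨a1, a2, a3, a4, a5, a6⟩ := hy
  simp only [leCum, Bool.and_eq_true, Nat.ble_eq, and_assoc] at h
  obtain ⟨b1, b2, b3, b4, b5, b6⟩ := h
  rify at b1 b2 b3 b4 b5 b6
  simp only [dot, toReal]
  have h1 := mul_le_mul_of_nonneg_left b1 (sub_nonneg.2 a1)
  have h2 := mul_le_mul_of_nonneg_left b2 (sub_nonneg.2 a2)
  have h3 := mul_le_mul_of_nonneg_left b3 a3
  have h4 := mul_le_mul_of_nonneg_left b4 (sub_nonneg.2 a4)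
  have h5 := mul_le_mul_of_nonneg_left b5 a5
  have h6 := mul_le_mul_of_nonneg_left b6 a6
  linarith

theorem Mono.dot_nonneg {y : Vec ℝ} (hy : y.Mono) {v : Vec ℝ} (hv : v.Nonneg) : 0 ≤ y.dot v := by
  obtain ⟨a1, a2, a3, a4, a5, a6⟩ := hy
  obtain ⟨b1, b2, b3, b4, b5, b6⟩ := hv
  have c2 : 0 ≤ y.s := a3.trans a2
  have c1 : 0 ≤ y.g := c2.trans a1
  have c4 : 0 ≤ y.d := a5.trans a4
  simp only [dot]
  positivity

end Vec

/-! ### A polytope that is closed under attaching -/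

/-- The pair `(n, v)` stands for the point `v / (20000 * lam ^ n)`. The polytope is generated by
these points. -/
def polytopePoints : List (ℕ × Vec ℕ) := [
  (1, ⟨0, 20000, 0, 0, 0, 20000⟩), (2, ⟨20000, 0, 0, 20000, 0, 0⟩),
  (3, ⟨0, 20000, 20000, 20000, 0, 20000⟩), (5, ⟨0, 20000, 60000, 60000, 0, 20000⟩),
  (7, ⟨0, 20000, 140000, 140000, 0, 20000⟩), (9, ⟨0, 20000, 300000, 300000, 0, 20000⟩),
  (11, ⟨0, 20000, 620000, 620000, 0, 20000⟩), (12, ⟨20000, 620000, 0, 20000, 620000, 620000⟩),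
  (13, ⟨620000, 35055, 158175, 640000, 104215, 640000⟩), (0, ⟨40, 211, 13275, 13276, 0, 215⟩),
  (0, ⟨32, 122, 13333, 13288, 0, 192⟩), (0, ⟨6038, 497, 1346, 10434, 536, 3504⟩),
  (0, ⟨5265, 1650, 1827, 4741, 622, 9314⟩), (0, ⟨212, 6506, 550, 207, 12926, 6646⟩),
  (0, ⟨14190, 0, 0, 4862, 198, 701⟩), (0, ⟨1252, 8585, 1321, 1308, 8585, 8639⟩),
  (0, ⟨14033, 34, 95, 5387, 171, 234⟩), (0, ⟨5896, 34, 1711, 13327, 29, 432⟩),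
  (0, ⟨7805, 441, 5929, 9977, 60, 484⟩), (0, ⟨6003, 292, 1569, 12102, 215, 1727⟩),
  (0, ⟨6329, 8, 1114, 13113, 82, 233⟩), (0, ⟨5673, 517, 1157, 9437, 3003, 3629⟩),
  (0, ⟨1224, 8516, 4258, 4406, 1075, 8797⟩), (0, ⟨2461, 7383, 4307, 4664, 1123, 7552⟩),
  (0, ⟨304, 9393, 4177, 4182, 1218, 9400⟩), (0, ⟨5815, 34, 1862, 13489, 2, 194⟩),
  (0, ⟨1692, 2927, 7572, 9761, 2849, 3539⟩), (0, ⟨152, 9353, 1755, 178, 9352, 9353⟩),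
  (0, ⟨7753, 220, 6142, 10153, 19, 264⟩), (0, ⟨341, 7034, 5503, 5828, 4180, 7059⟩),
  (0, ⟨5034, 4031, 816, 5251, 3816, 7036⟩), (0, ⟨6589, 1223, 325, 6697, 1247, 6714⟩),
  (0, ⟨6090, 961, 1140, 6934, 1096, 6976⟩), (0, ⟨5959, 154, 1682, 12882, 107, 858⟩),
  (0, ⟨2530, 6872, 1200, 3241, 5327, 8909⟩), (0, ⟨4921, 1837, 5370, 9510, 321, 3171⟩),
  (0, ⟨4885, 912, 6242, 11014, 171, 1574⟩), (0, ⟨5994, 247, 1583, 12096, 267, 1739⟩),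
  (0, ⟨4957, 3700, 3547, 6387, 612, 6388⟩)]

/-- The point of the polytope that a pair `(n, v)` stands for. -/
noncomputable def pointVal (q : ℕ × Vec ℕ) : Vec ℝ := q.2.toReal.smul (1 / (20000 * lam ^ q.1))

theorem pointVal_nonneg (q : ℕ × Vec ℕ) : (pointVal q).Nonneg :=
  (Vec.nonneg_toReal _).smul (by have := lam_pos; positivity)

/-- The weighted sum of points, relative to the factor `lam ^ e`, together with the sum of the
weights. A certificate is a list of alternating indices and weights; a missing last weight is `1`. -/
def combine (e : ℕ) : List ℕ → Vec ℕ × ℕ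
  | [] => (⟨0, 0, 0, 0, 0, 0⟩, 0)
  | [k] =>
    let q := polytopePoints.getD k (0, ⟨0, 0, 0, 0, 0, 0⟩)
    (q.2.smul (lamPowLower (e - q.1)), 1)
  | k :: w :: c =>
    let q := polytopePoints.getD k (0, ⟨0, 0, 0, 0, 0, 0⟩)
    let r := combine e c
    ((q.2.smul (w * lamPowLower (e - q.1))).add r.1, w + r.2)

/-- The certificate `c` shows that the product of the points `a` and `b` belongs to the polytope. -/
def checkCertificate (a b : ℕ × Vec ℕ) (c : List ℕ) : Bool :=
  let r := combine (a.1 + b.1 + 13) c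
  Nat.blt 0 r.2 && Vec.leCum ((a.2.mul b.2).smul (r.2 * 95 * 10 ^ 15)) (r.1.smul 20000)

/-- `r` holds for the corresponding elements of two lists of equal length. -/
def forallZip {α β : Type*} (r : α → β → Bool) : List α → List β → Bool
  | [], [] => true
  | a :: l, b :: m => r a b && forallZip r l m
  | _, _ => false

theorem exists_of_forallZip {α β : Type*} {r : α → β → Bool} :
    ∀ {l : List α} {m : List β}, forallZip r l m = true → ∀ a ∈ l, ∃ b, r a b = true
  | [], [], _, a, ha => by simp at ha
  | x :: l, y :: m, h, a, ha => by
    simp only [forallZip, Bool.and_eq_true] at h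
    rcases List.mem_cons.1 ha with rfl | ha
    · exact ⟨y, h.1⟩
    · exact exists_of_forallZip h.2 a ha

/-- The functionals that are bounded by `1` on the polytope. -/
def InPolar (y : Vec ℝ) : Prop := y.Mono ∧ ∀ q ∈ polytopePoints, y.dot (pointVal q) ≤ 1

/-- The vectors in the polytope and those which are dominated by one of these. -/
def InPolytope (v : Vec ℝ) : Prop := v.Nonneg ∧ ∀ y, InPolar y → y.dot v ≤ 1

theorem point_le (q : ℕ × Vec ℕ) (hq : q.1 ≤ 13) (e : ℕ) {y : Vec ℝ} (hy : y.Mono) :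
    lamPowLower (e + 13 - q.1) * y.dot q.2.toReal ≤
      10 ^ 15 * 20000 * lam ^ (e + 13) * y.dot (pointVal q) := by
  have hl := lam_pos
  rw [pointVal, Vec.dot_smul]
  have h1 := lamPowLower_le (e + 13 - q.1)
  have h2 : lam ^ (e + 13) = lam ^ (e + 13 - q.1) * lam ^ q.1 := by
    rw [← pow_add]
    congr 1
    omega
  have h3 := hy.dot_nonneg (Vec.nonneg_toReal q.2)
  calc _ ≤ 10 ^ 15 * lam ^ (e + 13 - q.1) * y.dot q.2.toReal := by gcongr
    _ = _ := by
      rw [h2]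
      field_simp

theorem fst_le_of_mem_polytopePoints : ∀ q ∈ polytopePoints, q.1 ≤ 13 := by decide +kernel

theorem weighted_getD_le {y : Vec ℝ} (hy : InPolar y) (e k : ℕ) :
    lamPowLower (e + 13 - (polytopePoints.getD k (0, ⟨0, 0, 0, 0, 0, 0⟩)).1) *
      y.dot (polytopePoints.getD k (0, ⟨0, 0, 0, 0, 0, 0⟩)).2.toReal ≤
      10 ^ 15 * 20000 * lam ^ (e + 13) := by
  have hl := lam_pos
  rcases lt_or_ge k polytopePoints.length with hk | hk
  · rw [List.getD_eq_getElem _ _ hk]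
    have hmem := List.getElem_mem hk
    refine (point_le _ (fst_le_of_mem_polytopePoints _ hmem) e hy.1).trans ?_
    exact mul_le_of_le_one_right (by positivity) (hy.2 _ hmem)
  · rw [List.getD_eq_default _ _ hk]
    simp only [Vec.toReal, Vec.dot, Nat.cast_zero, mul_zero, add_zero]
    positivity

theorem combine_le {y : Vec ℝ} (hy : InPolar y) (e : ℕ) : ∀ c : List ℕ,
    y.dot (combine (e + 13) c).1.toReal ≤
      10 ^ 15 * 20000 * lam ^ (e + 13) * (combine (e + 13) c).2
  | [] => by simp [combine, Vec.toReal, Vec.dot]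
  | [k] => by
    simp only [combine, Vec.toReal_smul, Vec.dot_smul, Nat.cast_one, mul_one]
    exact weighted_getD_le hy e k
  | k :: w :: c => by
    simp only [combine, Vec.toReal_add, Vec.toReal_smul, Vec.dot_smul, Vec.dot_add]
    push_cast
    have h1 := mul_le_mul_of_nonneg_left (weighted_getD_le hy e k) (Nat.cast_nonneg (α := ℝ) w)
    have h2 := combine_le hy e c
    linarith

theorem dot_mul_le_of_checkCertificate {a b : ℕ × Vec ℕ} {c : List ℕ}
    (h : checkCertificate a b c = true) {y : Vec ℝ} (hy : InPolar y) :
    y.dot ((pointVal a).mul (pointVal b)) ≤ 1 := by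
  have hl := lam_pos
  simp only [checkCertificate, Bool.and_eq_true, Nat.blt_eq] at h
  obtain ⟨h0, h1⟩ := h
  have h2 := hy.1.dot_le_dot h1
  have h3 := combine_le hy (a.1 + b.1) c
  rw [Vec.toReal_smul, Vec.toReal_smul, Vec.dot_smul, Vec.dot_smul, Vec.toReal_mul] at h2
  rw [pointVal, pointVal, Vec.smul_mul_smul, Vec.dot_smul]
  set r := combine (a.1 + b.1 + 13) c
  set t := y.dot (a.2.toReal.mul b.2.toReal)
  have h0' : (0 : ℝ) < r.2 := by exact_mod_cast h0
  rw [pow_add, lam_pow_thirteen] at h3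
  push_cast at h2
  have h4 : (r.2 * 95 * 10 ^ 15 : ℝ) * t ≤
      (r.2 * 95 * 10 ^ 15) * (20000 * 20000 * lam ^ (a.1 + b.1)) := by
    linarith
  have h5 := le_of_mul_le_mul_left h4 (by positivity)
  rw [div_mul_div_comm, mul_one, div_mul_eq_mul_div, one_mul, div_le_one (by positivity)]
  calc t ≤ _ := h5
    _ = _ := by rw [pow_add]; ring

/-- For each ordered pair of points a certificate that their product belongs to the polytope. -/
def certificates : List (List (List ℕ)) := [
  [[1], [2], [1, 3, 15, 4], [15, 6, 1, 1], [15], [15, 1, 7, 2], [7], [8], [14, 1, 18, 1, 23, 5],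
   [27], [0, 1, 27, 353], [18, 1, 0, 1, 22, 2, 23, 7], [14, 1, 18, 1, 23, 2], [12],
   [2, 6, 18, 5, 3, 45], [32], [38, 2, 2, 39, 18, 4, 26, 7, 3, 243],
   [26, 5, 0, 14, 2, 8, 29, 5, 24, 437], [0, 1, 34, 1, 29, 564],
   [29, 3, 0, 3, 18, 2, 22, 115, 23, 7], [26, 2, 0, 23, 2, 38, 29, 7, 24, 46],
   [22, 27, 0, 30, 38, 47, 29, 9, 18, 4], [17, 2, 1, 13, 15, 8, 30, 7, 18, 1],
   [17, 3, 1, 3, 15, 5, 30, 4, 18, 3], [30, 122, 1, 230, 15, 103, 21, 10, 20, 4],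
   [0, 22, 2, 19, 29, 20, 24, 38], [29, 3, 34, 239, 27, 1], [31], [0, 2, 34, 11, 29, 718, 27, 21],
   [30, 609, 0, 1, 1, 1, 20, 1, 15, 10], [38], [0, 1, 14, 3, 18, 5, 23, 17],
   [14, 2, 18, 1, 23, 8], [29, 1, 18, 2, 0, 3, 26, 2, 22, 34, 24, 112],
   [31, 92, 0, 9, 14, 7, 32, 10, 38, 45, 18, 22], [0, 1, 18, 2, 30, 1, 29, 4, 15, 3],
   [15, 5, 18, 1, 0, 2, 29, 9, 30, 1], [29, 3, 0, 3, 18, 1, 22, 135, 23, 12],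
   [15, 2, 30, 2, 29, 1, 18, 5, 0, 1]],
  [[1], [1], [1], [1], [1], [1], [1], [1], [1], [1], [1], [1], [1], [1], [1], [1], [1], [1], [1],
   [1], [1], [1], [1], [1], [1], [1], [1], [1], [1], [1], [1], [1], [1], [1], [1], [1], [1], [1],
   [1]],
  [[1], [3], [15, 1, 25, 1, 18, 1], [26, 1, 15, 1, 25, 1, 18, 1, 13, 1], [26, 1, 15, 1],
   [26, 2, 27, 1], [29], [1, 3, 11, 21, 31, 2], [18, 2, 23, 1], [29], [29], [3, 10, 18, 6, 23, 7],
   [14, 1, 18, 2, 23, 1], [12, 1, 11, 4], [3, 2, 18, 2, 4, 17], [31, 1, 1, 1, 11, 43],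
   [35, 2, 3, 13, 18, 1, 26, 1, 4, 99], [22, 2, 3, 11, 29, 1, 23, 1], [5, 2, 29, 2, 26, 1],
   [29, 2, 3, 18, 18, 3, 23, 7], [22, 3, 3, 21, 29, 1, 24, 2], [2, 1, 3, 7, 38, 6, 18, 2, 26, 1],
   [17, 2, 18, 2, 1, 1, 30, 1, 15, 1, 21, 1], [17, 2, 18, 2, 15, 1], [17, 1, 18, 1, 1, 2, 15, 1],
   [22, 1, 3, 8, 29, 1, 24, 1], [19, 1, 26, 2, 30, 1, 29, 1], [21, 1, 31, 2, 11, 18, 1, 3],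
   [5, 1, 29, 1, 26, 1], [17, 2, 26, 1, 30, 3, 18, 1], [35], [2, 1, 18, 5, 23, 2], [18, 2, 23, 1],
   [29, 6, 3, 48, 22, 1, 18, 1, 23, 13], [19, 3, 38, 3, 30, 1, 0, 1, 18, 10, 11, 15],
   [18, 2, 4, 1, 29, 3, 26, 1], [18, 1, 5, 1, 29, 3], [29, 1, 3, 13, 18, 2, 23, 5],
   [29, 1, 18, 3, 26, 2]],
  [[1], [4], [35], [35], [26], [26], [26], [1, 1, 11, 1, 19, 6], [18, 4, 23, 1], [26], [26],
   [3, 2, 18, 2, 4, 1], [14, 2, 18, 4, 23, 1], [17, 3, 11, 5], [5, 9, 18, 1, 4, 1], [19],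
   [26, 1, 5, 100, 18, 1, 36, 2, 4, 12], [29, 1, 3, 4, 18, 1, 4, 10], [26, 1, 5, 2],
   [3, 5, 18, 2, 4, 6], [18, 1, 3, 4, 29, 1, 4, 13], [35, 4, 36, 1, 4, 6, 18, 1, 26, 1],
   [18, 3, 1, 1, 15, 1, 21, 1, 20, 3], [18, 2, 26, 1, 25, 1], [18, 2, 1, 2, 15, 1, 21, 1, 20, 2],
   [18, 1, 3, 2, 29, 1, 4, 8], [26, 2, 4, 1, 36, 1, 33, 1], [11, 2, 37, 17, 1, 3],
   [26, 1, 5, 4, 29, 1], [17, 1, 18, 1, 26, 1, 33, 2, 30, 1, 21, 1], [36], [2, 1, 18, 5, 3, 1],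
   [18, 5, 23, 1], [29, 1, 3, 4, 18, 2, 4, 10], [19, 6, 18, 4, 33, 1, 35, 2],
   [26, 2, 5, 2, 18, 2, 29, 1], [26, 1, 5, 2, 18, 1, 29, 1], [3, 6, 18, 3, 4, 7], [26, 1, 18, 2]],
  [[1], [5], [35], [35], [26], [26], [26], [20, 6, 1, 1, 19, 5], [18, 16, 23, 1], [26], [26],
   [5, 1, 18, 1, 4, 1], [18], [11, 1, 17, 3], [6, 9, 5, 4, 18, 1], [33],
   [18, 4, 5, 27, 6, 211, 17, 2, 26, 1], [29, 1, 5, 14, 18, 1, 4, 7], [18, 1, 9, 1, 26, 1, 6, 2],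
   [5, 2, 18, 1, 4, 2], [29, 1, 5, 22, 18, 1, 4, 7], [26, 1, 5, 11, 18, 3, 36, 7, 33, 1],
   [18, 7, 13, 1, 15, 1, 25, 5, 20, 2], [28, 2, 26, 1, 25, 2], [18, 3, 1, 1, 15, 1, 25, 1, 20, 3],
   [18, 1, 5, 14, 29, 1, 4, 4], [17, 1, 5, 1, 26, 1, 6, 1, 18, 1], [20, 6, 37, 5, 1, 1],
   [18, 1, 5, 1, 26, 1, 6, 2], [17, 1, 26, 1, 18, 1, 25, 1],
   [33, 68, 5, 62, 18, 77, 36, 16, 26, 1], [5, 1, 18, 3, 4, 1], [18, 6, 3, 1],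
   [5, 6, 18, 1, 4, 4], [18, 5, 5, 1, 33, 10], [26, 1, 9, 1, 6, 1, 25, 1, 18, 1],
   [26, 1, 5, 1, 18, 1, 6, 1], [5, 2, 18, 1, 4, 2], [28, 1, 18, 1, 9, 1, 25, 1, 26, 1]],
  [[1], [6], [18], [18], [26], [26], [26], [20, 9, 1, 1, 19, 2], [18], [26], [26], [5, 2, 18, 1],
   [18], [11, 1, 17, 9], [9, 5, 28, 1, 6, 6], [25, 1, 17, 82, 21, 1, 18, 2, 20, 12, 15, 1],
   [9, 51, 18, 1, 6, 5], [6, 5, 5, 4, 18, 1], [28, 1, 9, 4, 25, 1, 26, 1], [6, 1, 5, 3, 18, 1],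
   [18, 1, 5, 7, 6, 16, 26, 1], [26, 1, 5, 3, 18, 4, 17, 2, 6, 8], [28, 1, 18, 1, 25, 1],
   [28, 3, 9, 1, 26, 1, 25, 3], [18, 1, 25, 1], [18, 1, 5, 5, 6, 10, 26, 1],
   [28, 1, 9, 1, 26, 1, 25, 1], [20, 8, 1, 1, 19, 2], [18, 1, 9, 4, 26, 1],
   [28, 2, 9, 1, 26, 1, 25, 4], [17, 2, 26, 1, 6, 22, 25, 23, 18, 28], [5, 1, 18, 2], [18],
   [6, 4, 5, 4, 18, 1], [6, 2, 17, 6, 26, 1, 18, 13, 25, 16], [36], [28, 1, 26, 1, 9, 2, 25, 1],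
   [6, 1, 5, 3, 18, 1], [25, 1, 26, 1, 28, 2, 9, 1]],
  [[1], [9], [18], [18], [18], [18], [18], [20], [18], [18], [18], [5, 2, 18, 1], [18], [17],
   [9, 9, 28, 1], [17], [9, 31, 25, 1], [9, 3, 6, 5, 18, 1], [25, 1, 9, 3, 28, 1, 26, 1],
   [6, 3, 5, 1, 18, 1], [9, 18, 6, 7, 18, 1, 26, 1], [25, 3, 28, 2, 9, 13, 18, 3, 26, 1],
   [28, 1, 25, 1], [28, 1, 25, 1], [1, 1, 28, 1, 25, 1], [9, 11, 6, 6, 18, 1, 26, 1],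
   [28, 1, 9, 1, 26, 1, 25, 1], [20, 8, 1, 1], [28, 1, 9, 3, 25, 1, 26, 1], [28, 1, 25, 2],
   [9, 4, 28, 5, 25, 4], [5, 1, 18, 2], [28], [6, 4, 9, 2, 18, 1], [28, 2, 25, 3],
   [25, 1, 26, 1, 28, 1, 9, 2], [25, 1, 26, 1, 28, 1, 9, 2], [6, 3, 5, 1, 18, 1], [36]],
  [[1], [29], [1, 1, 13, 1], [1, 1, 13, 3], [1, 1, 13, 6], [1, 1, 13, 14], [20, 1, 1, 1, 13, 22],
   [21, 1, 30, 1], [30], [20, 1, 1, 1, 13, 25], [20, 1, 1, 1, 13, 25], [30], [30],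
   [21, 1, 30, 2, 13, 1], [26], [21, 1, 30, 1], [26], [15, 2, 26, 1, 21, 1, 29, 2, 13, 2],
   [26, 1, 13, 1], [15, 1, 26, 1], [21, 1, 26, 1, 15, 1, 29, 2, 13, 2],
   [21, 1, 15, 2, 26, 1, 13, 1], [11], [11], [11], [15, 1, 29, 2, 13, 1], [21, 1, 30, 1, 13, 2],
   [21, 1, 30, 1], [26, 1, 13, 1], [21, 2, 15, 1, 30, 1, 13, 1], [30], [30], [30],
   [26, 1, 15, 1, 29, 1, 13, 1], [21, 1, 15, 1, 30, 1, 18, 1], [15, 1, 26, 1, 18, 1, 13, 2],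
   [15, 2, 26, 2, 25, 1, 18, 1, 13, 5], [15, 1, 26, 1], [18, 1, 13, 1, 21, 1, 15, 1, 20, 1]],
  [[1], [21, 4, 14, 13, 18, 18, 11, 276, 8, 12], [11], [21], [21, 1, 30, 1], [21, 1, 30, 1],
   [21, 1, 30, 1], [11], [21, 1, 11, 1, 14, 1, 18, 1, 8, 1], [21, 1, 30, 1], [21, 1, 30, 1],
   [21, 1, 14, 1, 8, 2, 11, 2], [21, 1, 11, 1, 14, 1, 18, 1, 37, 1], [11, 2, 32, 1],
   [18, 1, 21, 1, 11, 1, 14, 1, 37, 13], [11], [18, 1, 11, 3, 14, 1, 37, 16],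
   [21, 6, 14, 1, 8, 9, 11, 7, 18, 1], [21, 13, 11, 1, 14, 1, 18, 1, 8, 1],
   [21, 3, 14, 1, 8, 4, 11, 4], [21, 5, 14, 1, 18, 1, 11, 11, 8, 10],
   [21, 2, 14, 1, 8, 1, 11, 4, 31, 3], [11], [11], [11], [21, 7, 14, 1, 8, 10, 11, 7, 18, 1],
   [21, 3, 30, 1, 31, 1], [11], [21, 14, 30, 1, 14, 1, 18, 1, 8, 1], [11],
   [21, 1, 1, 1, 31, 1, 11, 2], [21, 1, 11, 2, 14, 1, 18, 1, 8, 1],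
   [21, 1, 11, 1, 14, 1, 18, 1, 8, 1], [21, 5, 14, 1, 8, 7, 11, 6, 18, 1], [11],
   [21, 4, 30, 1, 8, 1, 14, 1, 18, 1], [21, 3, 31, 1], [21, 3, 14, 1, 8, 4, 11, 4],
   [14, 1, 11, 1, 37, 1, 1, 1, 21, 3]],
  [[1], [25, 1, 10, 97], [18], [18], [18], [18], [18], [20], [18], [18], [18], [5, 2, 18, 1],
   [18], [17], [9, 9, 28, 1], [17], [9, 24, 25, 1], [9, 7, 6, 1, 18, 1], [9, 3, 25, 1, 28, 1],
   [6, 3, 18, 1, 9, 1], [28, 1, 9, 22, 25, 1], [25, 1, 28, 2, 9, 5], [28, 1, 25, 1],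
   [28, 1, 25, 1], [28], [28, 1, 9, 14, 25, 1], [28, 1, 9, 1, 25, 1], [20], [9, 3, 25, 1, 28, 1],
   [9, 1, 28, 1, 25, 2], [9, 4, 28, 5, 25, 4], [5, 1, 18, 2], [28], [9, 5, 6, 1, 18, 1],
   [28, 2, 25, 3], [25, 1, 28, 1, 9, 2], [25, 1, 28, 1, 9, 2], [6, 3, 18, 1, 9, 1], [36]],
  [[1], [10], [18], [18], [18], [18], [18], [20], [18], [18], [18], [6, 1, 5, 1, 18, 1], [18],
   [17], [28, 1, 9, 9], [17], [9, 17, 25, 1, 10, 5], [28, 1, 9, 13], [9, 3, 25, 1, 28, 1],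
   [6, 3, 9, 2, 18, 1], [25, 1, 9, 19, 28, 1], [25, 1, 28, 2, 9, 5], [28, 1, 25, 1],
   [28, 1, 25, 1], [28], [28, 1, 9, 12, 25, 1], [9, 1, 28, 1, 25, 1], [20], [9, 3, 25, 1, 28, 1],
   [9, 1, 28, 1, 25, 2], [9, 4, 28, 5, 25, 4], [5, 1, 18, 2], [28], [9, 6, 28, 1], [28, 2, 25, 3],
   [25, 1, 28, 1, 9, 2], [25, 1, 28, 1, 9, 2], [6, 3, 9, 2, 18, 1], [36]],
  [[1], [37], [11], [11], [11], [11], [11], [19], [33, 1, 37, 3, 16, 1, 1, 1, 21, 1], [11], [11],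
   [37, 4, 11, 1, 14, 1, 21, 1], [33, 1, 16, 1, 37, 1, 1, 1, 21, 1], [26, 1, 37, 15, 11, 6],
   [21, 1, 1, 2, 33, 52, 37, 3, 16, 1], [26, 3, 37, 20, 17, 4],
   [21, 1, 1, 1, 33, 30, 37, 13, 17, 14], [21, 1, 37, 7, 11, 3], [21, 1, 17, 1],
   [21, 2, 14, 1, 37, 9, 11, 3], [37, 2, 11, 1], [37, 1, 11, 1], [11], [11], [11],
   [21, 1, 37, 3, 11, 1], [21, 2, 26, 1, 37, 1, 17, 1], [19], [21, 1, 17, 1],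
   [21, 1, 26, 1, 37, 1, 17, 1], [19], [14, 1, 37, 2, 11, 1, 21, 1, 1, 1],
   [14, 1, 11, 1, 37, 2, 1, 1, 21, 1], [21, 3, 14, 1, 37, 15, 11, 5], [19], [19], [21, 2, 33, 1],
   [21, 2, 14, 1, 37, 9, 11, 3], [11]],
  [[1], [2, 19, 12, 21, 11, 128], [11], [21, 1, 30, 1], [21, 1, 30, 2, 13, 1],
   [21, 1, 30, 2, 13, 1], [21, 1, 30, 3, 13, 1], [12, 1, 11, 3],
   [21, 1, 30, 1, 31, 1, 14, 1, 18, 1, 8, 1], [21, 1, 30, 3, 13, 1], [30, 3, 13, 1],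
   [32, 3, 18, 1], [21, 1, 31, 1, 30, 1, 14, 1, 18, 1, 8, 1], [12, 3, 11, 4, 32, 1],
   [19, 6, 35, 1, 3, 1, 11, 3], [26, 2, 11, 13, 32, 7], [19, 4, 3, 1, 11, 3], [32, 5, 26, 1],
   [21, 8, 34, 1, 29, 1, 32, 1], [32, 7, 26, 1, 18, 1], [11, 1, 32, 7, 3, 1],
   [35, 1, 11, 1, 32, 5], [11], [11], [11], [26, 1, 32, 4], [21, 2, 34, 1, 30, 2],
   [26, 1, 11, 1, 32, 1], [21, 7, 34, 1, 29, 1, 32, 1], [21, 3, 34, 1, 32, 1], [8, 1, 11, 1],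
   [14, 1, 11, 1, 32, 2, 18, 1, 8, 1], [31, 1, 8, 1, 18, 1], [32, 5, 26, 1], [11, 2, 32, 1],
   [21, 1, 30, 1], [21, 1, 30, 1], [32, 7, 26, 1, 18, 1], [11]],
  [[1], [11], [11], [21], [25, 1, 13, 2], [25, 1, 13, 2], [25, 1, 13, 2], [11], [11],
   [25, 1, 13, 2], [25, 1, 13, 2], [21, 1, 18, 1, 26, 2, 25, 1, 13, 3], [8], [21, 1, 13, 1], [11],
   [11], [11], [10, 1, 25, 1, 13, 4], [21], [9, 1, 26, 2, 25, 1, 13, 4], [10, 1, 25, 1, 13, 4],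
   [21, 1, 26, 1, 13, 2], [11], [11], [11], [10, 1, 25, 1, 13, 4], [25, 1, 13, 2], [11], [21],
   [11], [11], [11], [11], [9, 1, 26, 1, 25, 1, 13, 4], [11], [11], [25, 1, 13, 2],
   [9, 1, 26, 1, 25, 1, 13, 4], [11]],
  [[14], [14, 1, 16, 2], [14], [14], [14], [14], [14], [18], [14], [14], [14], [14], [14], [8],
   [16], [1, 1, 14, 1, 31, 1, 21, 1], [16], [14, 2, 16, 1], [14], [14], [14, 2, 16, 1], [14],
   [14], [14], [14], [14, 2, 16, 1], [14], [18], [14], [14], [14], [14], [14], [14], [14], [14],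
   [14], [14], [14]],
  [[1], [18, 1, 15, 1, 29, 1, 26, 1], [13, 1, 1, 1], [25, 1, 15, 1, 1, 1, 13, 3],
   [25, 2, 1, 1, 15, 2, 13, 6], [25, 1, 15, 1, 13, 3], [25, 1, 15, 1, 13, 5],
   [21, 2, 30, 1, 31, 1], [29, 1, 14, 1, 18, 1, 15, 1], [25, 1, 18, 1, 15, 1, 13, 9],
   [25, 1, 18, 1, 15, 1, 13, 9], [18, 2, 15, 2, 29, 1, 26, 1], [29, 1, 14, 1, 18, 1, 15, 1],
   [21, 1, 30, 2, 13, 1], [26], [21, 2, 30, 1, 31, 1], [26], [26, 1, 15, 1],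
   [15, 1, 26, 2, 18, 1, 13, 1], [26, 1, 15, 2, 18, 1, 29, 1], [26, 1, 15, 1], [15, 2, 18, 1],
   [21, 1, 18, 1, 15, 1, 1, 1, 20, 1], [35], [20, 1, 13, 1, 15, 1, 1, 2, 21, 1], [26, 1, 15, 1],
   [21, 4, 18, 1, 15, 3, 26, 1, 13, 4], [21, 2, 30, 1, 31, 1], [15, 1, 26, 2, 18, 1, 13, 1],
   [21, 4, 15, 1, 16, 1, 13, 2], [21, 1, 15, 1, 18, 1, 30, 1], [29, 1, 14, 1, 18, 1, 15, 1],
   [29, 1, 14, 1, 18, 1, 15, 1], [26, 2, 15, 3, 18, 1, 13, 1], [21, 1, 30, 1],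
   [21, 1, 15, 1, 26, 1, 18, 1, 13, 1], [15, 1, 26, 1, 18, 1, 13, 2],
   [26, 1, 15, 2, 18, 1, 29, 1], [15, 1, 18, 1]],
  [[14], [16, 43, 1, 1], [14], [14], [14], [14], [14], [16], [14], [14], [14], [14], [14], [8],
   [16], [16, 1, 1, 1, 21, 1], [16, 19, 1, 1], [16], [16], [16], [16], [16], [14], [14], [14],
   [16], [14], [16], [16], [14], [16], [14], [14], [16], [16], [14], [14], [16], [14]],
  [[1], [20, 1, 17, 1, 25, 11], [11], [11], [11], [11], [11], [17], [18], [11], [11],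
   [25, 1, 18, 1, 17, 1, 1, 1, 20, 1], [18], [25, 1, 17, 1], [17], [26, 1, 25, 138, 13, 1], [25],
   [17], [17], [20, 4, 25, 2, 17, 2, 18, 1, 1, 1], [17], [17], [11], [17], [11], [17], [17], [17],
   [17], [17], [17], [17, 1, 18, 1, 25, 1, 1, 1, 20, 1], [25, 1, 18, 1, 17, 1, 1, 1, 20, 1], [17],
   [17], [17], [17], [20, 6, 25, 2, 17, 3, 18, 1, 1, 1], [17]],
  [[1, 2, 16, 1], [25, 1, 18, 1, 28, 241, 1, 1], [18], [18], [18], [18], [18], [18],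
   [14, 2, 18, 3], [18], [18], [14, 1, 18, 4], [14, 2, 18, 1], [11], [16, 1, 28, 23], [28], [28],
   [16, 1, 28, 9, 18, 8], [18], [14, 1, 18, 9], [18], [16, 1, 28, 3, 1, 1, 18, 3],
   [16, 1, 18, 1, 28, 1, 1, 1], [16, 1, 28, 1, 1, 1, 18, 1], [16, 1, 28, 1, 1, 2, 18, 1], [18],
   [18], [18], [18], [18], [16, 1, 28, 2, 1, 2, 18, 2], [14, 3, 18, 5], [14, 2, 18, 3],
   [16, 1, 28, 6, 18, 7], [16, 1, 17, 1, 1, 2, 21, 1, 18, 1], [16, 1, 18, 1, 28, 2, 1, 1], [18],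
   [14, 1, 18, 9], [16, 1, 18, 1, 28, 2, 1, 1]],
  [[1], [36, 1, 17, 1, 33, 353, 18, 1], [11], [11], [11], [11], [11], [33],
   [16, 1, 17, 1, 33, 1, 18, 1, 21, 1], [11], [11], [37, 1, 33, 5, 16, 1, 1, 1, 21, 1], [18],
   [37, 4, 17, 3], [17, 107, 1, 5, 15, 1, 18, 3, 25, 1, 0, 1], [37, 1, 17, 2],
   [1, 1, 17, 86, 30, 1, 18, 1], [21, 1, 33, 9, 37, 2], [21, 1, 25, 2, 20, 1],
   [37, 2, 33, 8, 16, 1, 21, 1], [33, 2, 37, 1], [19], [11], [11], [11], [21, 1, 33, 7, 37, 2],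
   [19], [33], [19], [19], [19], [16, 1, 33, 2, 1, 1, 21, 1, 37, 1],
   [16, 1, 33, 2, 1, 1, 21, 1, 37, 1], [21, 2, 16, 1, 33, 22, 37, 5], [19], [19], [19],
   [37, 2, 33, 8, 16, 1, 21, 1], [11]],
  [[1], [20, 10, 25, 1], [11], [11], [11], [11], [11], [17], [18], [11], [11],
   [20, 2, 25, 1, 1, 1], [18], [17], [20], [17], [20], [20], [17], [20, 2, 25, 1, 1, 1], [20],
   [20], [11], [11], [11], [20], [17], [17], [17], [17], [17], [20, 1, 25, 1, 1, 1], [18], [20],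
   [17], [17], [17], [20, 2, 25, 1, 1, 1], [11]],
  [[1], [21, 1, 25, 1], [11], [11], [11], [11], [11], [37], [21, 1, 1, 1], [11], [11],
   [21, 3, 1, 1, 20, 1], [21, 1, 18, 1, 1, 1, 20, 1], [26, 2, 25, 1],
   [21, 1, 18, 1, 25, 2, 20, 1], [26, 5, 25, 8, 13, 1], [21, 1, 25, 2, 20, 1], [21, 2, 25, 1],
   [21, 1, 25, 1], [21, 2, 20, 1], [21, 2, 25, 1], [21, 2, 20, 1], [11], [11], [11],
   [21, 2, 25, 1], [21], [26, 1, 25, 1], [21, 1, 25, 1], [21, 1, 25, 3, 13, 1], [19],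
   [21, 1, 1, 1], [21, 1, 1, 1], [21, 2, 20, 1], [19], [21], [21], [21, 2, 20, 1], [11]],
  [[1], [29, 3, 3, 30, 18, 4, 23, 11], [1, 1, 15, 2, 21, 1, 18, 1, 20, 1],
   [15, 2, 25, 1, 18, 1, 13, 1], [13, 1, 15, 2, 26, 1, 18, 1], [15, 1, 26, 1], [15, 1, 26, 1],
   [1, 1, 11, 3, 31, 3], [14, 1, 18, 3, 23, 3], [15, 1, 26, 1], [15, 1, 26, 1],
   [29, 1, 3, 2, 18, 4, 23, 7], [14, 1, 18, 1, 23, 1], [11, 1, 32, 2], [3, 6, 18, 3, 4, 4],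
   [21, 3, 14, 1, 31, 4, 11, 7, 8, 1], [29, 1, 3, 4, 18, 2, 4, 4], [18, 2, 3, 11, 29, 9, 23, 16],
   [18, 1, 5, 1, 29, 4, 26, 2], [29, 51, 3, 79, 18, 48, 23, 144],
   [29, 6, 3, 12, 22, 4, 18, 2, 23, 11], [29, 1, 22, 3, 38, 2, 18, 2, 26, 1],
   [1, 2, 15, 1, 21, 1, 18, 1], [17, 1, 1, 1, 15, 1, 21, 1, 18, 2, 30, 1],
   [1, 2, 15, 1, 21, 1, 18, 1], [18, 1, 3, 4, 22, 1, 29, 4, 23, 5], [26, 2, 15, 1, 30, 3],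
   [21, 2, 1, 1, 11, 2, 31, 3], [18, 1, 5, 1, 29, 4, 26, 1], [21, 1, 30, 2, 18, 1],
   [30, 1, 11, 1, 38, 4, 18, 3, 26, 1], [14, 1, 18, 3, 23, 3], [14, 1, 18, 3, 23, 3],
   [29, 10, 3, 12, 18, 4, 23, 19], [31, 4, 14, 1, 11, 5, 30, 3, 18, 5],
   [18, 2, 26, 1, 30, 1, 29, 2, 15, 1], [18, 1, 15, 1, 29, 2, 26, 1],
   [29, 13, 3, 19, 18, 12, 23, 36], [29, 1, 34, 1, 18, 3]],
  [[1, 3, 16, 1], [3, 7, 18, 5, 23, 5], [1, 1, 15, 1, 18, 1], [30], [15, 1, 18, 1],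
   [13, 1, 15, 2, 18, 1, 26, 1], [30], [1, 1, 11, 1, 31, 2], [14, 1, 18, 2, 23, 2], [30], [30],
   [18, 4, 23, 5], [14, 1, 18, 1, 23, 1], [26, 1, 11, 1, 32, 2], [3, 1, 18, 1],
   [21, 1, 14, 1, 8, 1, 11, 3, 31, 1], [3, 2, 18, 1], [29, 2, 3, 5, 18, 4, 23, 9],
   [18, 2, 5, 1, 29, 3, 26, 1], [29, 1, 3, 6, 18, 9, 23, 15], [29, 1, 3, 3, 18, 2, 23, 5],
   [29, 2, 34, 1, 18, 6, 0, 2], [1, 2, 15, 1, 21, 1, 18, 1, 16, 1],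
   [1, 1, 15, 1, 21, 1, 18, 2, 16, 1], [21, 1, 1, 2, 15, 1, 30, 1, 18, 1, 16, 1],
   [29, 1, 3, 1, 18, 1, 23, 2], [21, 1, 15, 1, 30, 2, 18, 1, 26, 1], [21, 1, 1, 1, 11, 1, 31, 2],
   [18, 2, 5, 1, 29, 4], [16, 1, 18, 1, 1, 1, 30, 2, 15, 1, 21, 2], [38, 1, 18, 1],
   [14, 1, 18, 2, 23, 2], [14, 1, 18, 2, 23, 2], [29, 1, 3, 3, 18, 3, 23, 6],
   [31, 1, 14, 1, 11, 3, 30, 2, 18, 3], [29, 1, 18, 1], [18, 2, 29, 3],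
   [29, 1, 3, 6, 18, 9, 23, 15], [29, 1, 14, 1, 18, 3, 15, 1]],
  [[1], [22, 3, 3, 15, 29, 2, 23, 1], [18, 1, 1, 1, 25, 1, 15, 2], [15, 2, 25, 1, 18, 1, 13, 1],
   [26, 1, 15, 2], [21, 1, 26, 1, 15, 2, 29, 1, 13, 1], [15, 2, 26, 1, 21, 1, 29, 2, 13, 2],
   [1, 1, 11, 4, 31, 4], [18, 1, 23, 1], [15, 1, 29, 2, 13, 1], [29],
   [29, 2, 3, 5, 18, 4, 23, 10], [14, 2, 18, 3, 23, 2], [11, 1, 32, 4],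
   [29, 1, 3, 6, 18, 2, 4, 7], [21, 2, 8, 1, 31, 2, 11, 4, 32, 1], [29, 1, 3, 3, 18, 1, 4, 5],
   [22, 7, 3, 9, 29, 7, 23, 3], [5, 1, 29, 3, 26, 2], [29, 4, 3, 5, 18, 1, 23, 7],
   [22, 9, 3, 10, 29, 5], [18, 1, 22, 4, 38, 2, 26, 3], [17, 1, 18, 2, 1, 3, 21, 1, 15, 2, 30, 1],
   [17, 1, 18, 2, 1, 1, 21, 1, 15, 1, 30, 1], [21, 1, 18, 1, 1, 4, 15, 2], [22, 1, 3, 1, 29, 1],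
   [34, 1, 26, 1, 15, 1, 30, 1, 21, 1, 29, 1], [21, 3, 1, 1, 11, 3, 31, 5], [5, 1, 29, 3, 26, 2],
   [21, 2, 17, 1, 15, 1, 30, 3, 18, 1], [11, 2, 32, 1, 38, 10, 18, 5, 26, 4], [18, 1, 23, 1],
   [18, 1, 23, 1], [22, 2, 3, 6, 29, 5, 23, 5], [31, 5, 32, 1, 11, 7, 30, 4, 18, 8, 0, 1],
   [18, 1, 15, 1, 29, 1, 26, 1], [18, 1, 29, 4, 26, 1], [29, 4, 3, 5, 18, 1, 23, 7],
   [29, 2, 30, 1, 18, 3]],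
  [[1], [25], [11], [11], [11], [11], [11], [17], [28], [11], [11], [28, 1, 25, 3, 1, 1], [18],
   [25], [17], [25], [25], [17], [17], [33], [17], [17], [11], [17], [11], [17], [17], [17], [17],
   [17], [17], [28, 1, 25, 2, 1, 1], [28, 1, 25, 1, 1, 1], [17], [17], [17], [17], [33], [17]],
  [[1], [28, 1, 9, 11, 26, 14, 25, 4], [25, 1, 18, 1, 13, 1, 21, 1, 20, 1],
   [21, 1, 18, 1, 26, 1, 25, 1, 13, 1], [26, 1, 25, 1, 13, 1], [26], [26], [21, 1, 20, 1],
   [26, 1, 18, 2], [26], [26], [28, 1, 26, 2], [30, 1, 14, 1, 18, 4, 15, 1],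
   [21, 1, 26, 1, 25, 1], [28, 1, 9, 4, 26, 2, 25, 1], [21, 9, 25, 14, 13, 1],
   [28, 1, 9, 6, 26, 3, 25, 2], [28, 1, 9, 4, 26, 13, 25, 2], [9, 5, 26, 5, 25, 3, 13, 1],
   [28, 2, 9, 2, 26, 8, 25, 1], [28, 1, 9, 9, 26, 25, 25, 4], [28, 1, 26, 3, 25, 1],
   [18, 1, 1, 1, 15, 1, 21, 1, 20, 2], [21, 1, 18, 2, 26, 1, 25, 3],
   [18, 1, 1, 1, 15, 1, 21, 1, 20, 2], [9, 2, 26, 6, 25, 1], [26, 3, 25, 3, 13, 1],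
   [21, 1, 25, 1], [9, 3, 26, 3, 25, 2, 13, 1], [21, 2, 26, 1, 25, 3],
   [21, 1, 26, 2, 25, 2, 28, 2], [28, 2, 26, 1, 21, 1, 18, 1], [26, 1, 18, 2],
   [28, 1, 9, 2, 26, 7, 25, 1], [18, 2, 25, 3, 21, 3], [28, 1, 26, 2, 25, 1],
   [9, 1, 26, 4, 25, 2], [28, 2, 9, 2, 26, 8, 25, 1], [36]],
  [[1], [29], [25, 1, 15, 1, 1, 1, 13, 1], [25, 2, 1, 1, 15, 2, 13, 4], [18, 1, 13, 6],
   [15, 1, 26, 1, 18, 1, 13, 9], [26, 1, 13, 9], [21, 1, 30, 1, 31, 1],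
   [29, 1, 14, 1, 18, 1, 15, 1], [26, 1, 13, 7], [26, 1, 13, 7], [18, 1, 26, 1, 29, 2, 15, 1],
   [29, 1, 14, 1, 18, 1, 23, 1], [21, 1, 30, 3, 13, 1], [26], [21, 1, 30, 1], [26],
   [27, 1, 29, 1, 26, 1], [26, 2, 27, 1, 13, 1], [15, 2, 18, 1, 29, 2, 26, 1], [29],
   [15, 3, 18, 1, 26, 1], [21, 1, 18, 1, 15, 1, 1, 1, 20, 1], [35],
   [20, 1, 13, 1, 15, 1, 1, 2, 21, 1], [27, 1, 29, 1, 26, 1], [21, 1, 15, 1, 13, 1],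
   [21, 2, 30, 1, 31, 1], [26, 2, 27, 1, 13, 1], [21, 2, 15, 1], [30],
   [29, 1, 14, 1, 18, 1, 15, 1], [29, 1, 14, 1, 18, 1, 15, 1], [15, 1, 27, 1, 29, 1, 26, 1],
   [21, 1, 30, 1], [15, 1, 26, 1, 18, 1, 13, 1], [15, 1, 26, 1, 13, 1],
   [15, 2, 18, 1, 29, 2, 26, 1], [15, 1, 18, 1]],
  [[1, 2, 16, 1], [25, 4, 28, 288, 9, 1], [18], [18], [18], [18], [18], [18], [14, 1, 18, 2],
   [18], [18], [14, 1, 18, 5], [14, 2, 18, 1], [11], [16, 1, 28, 24, 1, 1],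
   [25, 1, 18, 1, 17, 1, 1, 1, 20, 1], [28], [18], [18], [16, 1, 28, 4, 18, 6], [28],
   [16, 1, 28, 7, 1, 2], [16, 1, 28, 1, 1, 1], [16, 1, 28, 1, 1, 1], [16, 1, 28, 1, 1, 1], [18],
   [18], [18], [18], [18], [16, 1, 28, 4, 1, 3], [14, 1, 18, 2], [14, 2, 18, 3],
   [16, 1, 28, 12, 18, 1], [18, 1, 1, 2], [16, 1, 28, 2, 1, 1], [18], [16, 1, 28, 4, 18, 6],
   [16, 1, 28, 2, 1, 1]],
  [[1], [5, 2, 29, 2, 26, 1], [18, 1, 1, 1, 25, 2, 15, 2], [18, 1, 26, 1, 15, 1, 25, 1, 13, 1],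
   [25, 1, 26, 1, 15, 1, 18, 1, 13, 2], [26, 1, 13, 1], [26, 1, 13, 1], [11],
   [29, 1, 18, 3, 23, 1], [26, 1, 13, 1], [26, 1, 13, 1], [18, 3, 5, 1, 29, 5, 26, 1],
   [29, 1, 14, 1, 18, 2, 23, 1], [21, 4, 29, 1, 32, 1], [26, 1, 5, 3, 18, 1, 29, 1], [21],
   [26, 2, 5, 4, 18, 1, 29, 1], [5, 1, 29, 3, 26, 2], [26, 11, 13, 1],
   [18, 1, 5, 1, 29, 4, 26, 1], [5, 1, 29, 3, 26, 1], [18, 1, 30, 1, 29, 2, 26, 2],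
   [18, 1, 1, 1, 21, 1, 15, 1, 20, 1], [25, 1, 18, 2, 13, 1, 15, 1, 21, 1, 20, 1],
   [21, 1, 15, 1, 18, 1, 1, 1, 20, 1], [5, 1, 29, 3, 26, 2], [21, 2, 15, 1, 26, 3, 13, 1],
   [21, 13, 1, 1, 14, 1, 31, 1], [26, 10, 13, 1], [21, 4, 13, 1, 25, 1, 15, 1, 18, 1],
   [26, 3, 30, 2, 18, 3, 21, 1], [29, 2, 18, 5, 23, 1], [29, 2, 18, 4, 23, 1],
   [18, 1, 5, 2, 29, 6, 26, 3], [1, 1, 18, 2, 30, 1, 15, 1, 21, 2, 17, 1],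
   [26, 4, 15, 1, 18, 2, 13, 1], [18, 1, 26, 4, 15, 1, 13, 1], [18, 1, 5, 1, 29, 4, 26, 1],
   [26, 2, 18, 3, 13, 1]],
  [[1], [18, 1, 37, 1, 26, 1, 30, 3, 33, 2], [13, 1, 20, 1, 1, 1, 21, 1], [21, 3, 16, 1, 13, 2],
   [21, 3, 15, 1, 16, 1, 13, 1], [21, 2, 13, 1], [21, 1, 30, 1, 13, 1], [11],
   [21, 1, 30, 1, 18, 1, 16, 1], [21, 1, 30, 1, 13, 1], [21, 1, 30, 1, 13, 1],
   [30, 2, 18, 1, 21, 1], [16, 1, 21, 1], [21, 1, 26, 1, 29, 1, 32, 1],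
   [37, 1, 18, 2, 26, 1, 33, 2, 30, 1, 21, 1], [21], [37, 1, 18, 2, 26, 2, 33, 2, 30, 1, 21, 1],
   [21, 4, 17, 1, 15, 1, 26, 1, 30, 7, 18, 2], [21, 10, 13, 3, 25, 2, 26, 1, 15, 2, 18, 4],
   [21, 1, 30, 2, 18, 1], [21, 2, 17, 1, 15, 1, 30, 5, 26, 1, 18, 2], [21, 1, 18, 1, 30, 2],
   [21, 1, 13, 1, 20, 1, 1, 2], [11], [21, 1, 13, 1, 20, 1, 1, 2],
   [21, 2, 17, 1, 15, 1, 30, 4, 18, 1], [21, 4, 15, 1], [11],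
   [21, 10, 13, 4, 25, 2, 26, 1, 15, 2, 18, 5], [21, 7, 15, 1, 16, 1, 13, 1],
   [21, 3, 16, 1, 30, 2, 37, 1, 18, 1, 11, 1], [21, 1, 30, 1, 18, 1, 16, 1],
   [21, 1, 30, 1, 18, 1, 16, 1], [21, 3, 17, 1, 15, 1, 30, 5, 18, 2], [11],
   [21, 3, 20, 1, 15, 2, 1, 1, 18, 1], [21, 3, 15, 1, 18, 1], [21, 1, 30, 2, 18, 1],
   [18, 1, 1, 1, 21, 2, 15, 1, 16, 1]],
  [[1], [19, 9, 30, 3, 31, 9, 11, 56, 1, 11], [11], [11], [21, 1, 30, 1], [21, 1, 30, 1],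
   [21, 1, 30, 1], [11], [11, 1, 16, 1, 31, 1, 21, 1], [21, 1, 30, 1], [21, 1, 30, 1],
   [21, 1, 1, 1, 11, 1, 31, 2], [21, 1, 16, 1, 11, 1, 30, 1, 1, 1, 31, 1], [11, 2, 32, 1],
   [11, 1, 1, 1, 19, 3], [11], [11, 2, 21, 1, 1, 2, 19, 9], [21, 5, 30, 1, 1, 3, 11, 5, 31, 9],
   [21, 16, 30, 1, 1, 2], [21, 2, 1, 1, 11, 1, 31, 3], [21, 5, 30, 1, 1, 3, 11, 10, 31, 11],
   [21, 2, 1, 1, 11, 2, 31, 3], [11], [11], [11], [21, 5, 30, 1, 1, 2, 11, 4, 31, 7],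
   [21, 3, 30, 1, 31, 1], [11], [21, 12, 30, 1, 1, 1, 14, 1], [11], [21, 1, 1, 1, 31, 1, 11, 2],
   [11, 1, 14, 1, 31, 1, 1, 1, 21, 1], [11, 1, 16, 1, 31, 1, 1, 1, 21, 1],
   [21, 2, 1, 1, 11, 2, 31, 4], [11], [21, 5, 30, 1, 14, 1, 31, 1], [21, 3, 31, 1],
   [21, 2, 1, 1, 11, 1, 31, 3], [21, 2, 1, 1]],
  [[1], [35, 2, 18, 6, 26, 1, 11, 189, 32, 3], [11], [21, 3, 30, 1], [21, 1, 30, 1],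
   [21, 1, 30, 1], [21, 1, 30, 1], [11], [14, 1, 11, 1, 18, 1, 8, 1, 21, 1], [21, 1, 30, 1],
   [21, 1, 30, 1], [21, 1, 31, 1, 14, 1, 8, 1, 11, 3], [21, 1, 11, 1, 14, 1, 18, 1, 37, 1],
   [26, 2, 11, 9, 32, 5], [11, 1, 37, 10, 18, 1], [26, 1, 11, 4], [18, 1, 37, 23, 11, 4],
   [21, 4, 31, 1, 8, 1, 18, 1, 11, 6, 32, 5], [21, 14, 32, 1, 18, 1, 11, 2, 26, 1],
   [21, 3, 31, 3, 18, 1, 11, 6, 8, 2], [21, 4, 18, 1, 11, 11, 32, 9], [21, 1, 31, 2, 11, 2], [11],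
   [11], [11], [21, 6, 18, 1, 11, 7, 32, 9], [21, 2, 30, 1], [26, 1, 11, 2],
   [21, 9, 32, 1, 18, 1, 11, 1, 26, 1], [21], [11], [8, 1, 21, 1, 11, 2, 14, 1, 18, 1],
   [11, 1, 14, 1, 18, 1, 8, 1, 21, 1], [21, 3, 31, 2, 32, 1, 18, 1, 11, 4, 8, 2], [11], [11],
   [21, 3, 31, 1], [21, 3, 31, 3, 18, 1, 11, 6, 8, 2], [21, 2, 11, 1, 1, 1]],
  [[1], [1, 2, 17, 136, 25, 27, 18, 1, 15, 1], [11], [11], [11], [11], [11], [17], [18], [11],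
   [11], [17, 7, 30, 1, 33, 1, 18, 1, 1, 2, 21, 1], [18], [37, 1, 17, 8],
   [18, 1, 17, 1, 20, 5, 25, 12], [17], [17, 12, 21, 1, 15, 1, 20, 24, 25, 101, 18, 2], [33],
   [17], [17, 16, 1, 2, 33, 1, 18, 1, 30, 1, 21, 1], [33], [33], [11], [17], [11], [33], [19],
   [17], [33], [17], [17], [17, 2, 16, 1, 33, 1, 18, 1, 1, 1, 21, 1],
   [17, 1, 16, 1, 33, 1, 18, 1, 1, 1, 21, 1], [33], [17], [17], [19],
   [17, 15, 1, 2, 33, 1, 18, 1, 30, 1, 21, 1], [17]],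
  [[1], [19, 1, 26, 2, 30, 1, 29, 1], [21, 1, 1, 1, 13, 1], [21, 3, 16, 1, 13, 4],
   [21, 2, 15, 1, 13, 2], [21, 1, 30, 1, 13, 2], [21, 1, 30, 1, 13, 2], [21, 2, 30, 1],
   [30, 1, 18, 1], [21, 1, 30, 1, 13, 2], [21, 1, 30, 1, 13, 2],
   [21, 1, 15, 1, 30, 2, 18, 1, 26, 1], [30, 1, 16, 1, 21, 1, 18, 1, 15, 1], [21, 1, 34, 1],
   [26, 1, 36, 1], [21, 2, 30, 1], [36, 1, 26, 2], [34, 1, 26, 1, 15, 1, 30, 1, 21, 1, 29, 1],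
   [21, 2, 18, 1, 15, 1, 26, 3, 13, 2], [26, 2, 15, 1, 30, 3],
   [30, 2, 21, 1, 15, 1, 26, 2, 34, 1, 29, 1], [21, 1, 30, 3, 15, 1, 26, 1],
   [21, 1, 20, 1, 1, 1, 15, 1], [11], [21, 1, 13, 1, 20, 1, 1, 2, 15, 1],
   [30, 1, 26, 1, 15, 1, 21, 1, 34, 1, 29, 1], [21, 6, 15, 1, 34, 1, 30, 3, 13, 5],
   [21, 1, 30, 1], [21, 2, 15, 1, 26, 3, 13, 1], [21, 4, 15, 1, 30, 1], [21, 2, 30, 2, 18, 1],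
   [30, 1, 18, 1], [30, 1, 18, 1], [26, 2, 15, 1, 30, 2], [21, 2, 30, 1],
   [21, 2, 13, 1, 15, 1, 26, 1, 18, 1], [21, 1, 15, 1, 26, 1], [26, 2, 15, 1, 30, 3],
   [18, 1, 21, 1, 15, 1]],
  [[1], [36], [18, 1, 1, 1, 21, 1, 15, 1, 20, 1], [35], [35], [35], [35], [19],
   [30, 1, 31, 1, 14, 1, 18, 6], [35], [35], [26, 1, 35, 2, 11, 1, 18, 5],
   [30, 1, 16, 1, 14, 1, 18, 2, 21, 1], [17, 1, 11, 2], [33, 3, 36, 2, 18, 5, 5, 3], [19],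
   [33, 17, 36, 10, 18, 20, 5, 14, 26, 1], [36, 3, 26, 1, 11, 1, 35, 2, 18, 2],
   [17, 1, 26, 2, 18, 2], [36, 2, 26, 1, 35, 2, 11, 1, 18, 3],
   [36, 7, 26, 1, 11, 1, 35, 4, 18, 2], [35, 1, 11, 1, 18, 1], [18, 1, 1, 2, 21, 1, 15, 1, 20, 1],
   [18, 1, 1, 1, 21, 1, 20, 1], [21, 1, 15, 1, 18, 1, 1, 2, 20, 1],
   [36, 3, 26, 1, 11, 1, 35, 2, 18, 1], [18, 1, 21, 1], [19], [17, 1, 26, 2, 18, 2],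
   [17, 3, 18, 1, 1, 1, 15, 1, 21, 2, 30, 1], [11, 2, 16, 1, 19, 7, 30, 1, 18, 8],
   [30, 1, 11, 3, 31, 1, 14, 2, 18, 14, 0, 1], [30, 1, 11, 1, 14, 1, 18, 8],
   [36, 2, 26, 1, 11, 1, 35, 2, 18, 2], [16, 1, 18, 1, 21, 1, 33, 1, 30, 1, 37, 4],
   [26, 1, 18, 2, 21, 1], [37, 1, 26, 1, 11, 1, 18, 2, 21, 1],
   [36, 2, 26, 1, 35, 2, 11, 1, 18, 3], [21, 1, 1, 1, 18, 2]],
  [[1], [33, 75, 5, 69, 18, 87, 36, 13, 26, 2], [18, 1, 1, 1, 15, 1, 21, 1, 20, 1], [35], [35],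
   [35], [35], [19], [21, 1, 14, 1, 37, 1, 16, 1, 18, 3], [35], [35],
   [36, 2, 18, 7, 33, 2, 26, 1], [16, 1, 21, 1, 1, 1, 18, 2], [19],
   [26, 1, 25, 8, 18, 12, 17, 1, 6, 7], [19], [17, 6, 25, 6, 26, 1, 6, 10, 18, 14],
   [33, 2, 36, 2, 18, 3, 5, 1, 26, 1], [28, 1, 26, 1, 25, 1], [33, 2, 36, 2, 18, 5, 5, 1, 26, 1],
   [33, 3, 36, 3, 18, 4, 5, 2, 26, 1], [36, 4, 18, 5, 33, 4, 26, 1], [18], [18], [18],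
   [33, 3, 36, 3, 18, 4, 5, 2, 26, 1], [28, 1, 21, 1, 26, 1, 25, 1], [19],
   [28, 2, 9, 1, 26, 1, 25, 1], [17, 1, 18, 1, 21, 1, 20, 2], [16, 1, 18, 4, 21, 1, 33, 4, 37, 1],
   [18, 3, 37, 1], [16, 1, 21, 1, 14, 1, 37, 1, 18, 4], [33, 2, 36, 2, 18, 3, 5, 1, 26, 1],
   [16, 1, 18, 1, 33, 2, 17, 1, 21, 1], [28, 2, 21, 1, 25, 1, 26, 1], [36],
   [33, 2, 36, 2, 18, 5, 5, 1, 26, 1], [21, 1, 1, 1, 18, 3, 20, 1]],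
  [[1], [21, 5, 1, 1, 33, 361, 37, 26, 17, 78], [11], [11], [11], [11], [11], [33],
   [16, 1, 17, 1, 33, 1, 1, 1, 21, 1], [11], [11], [37, 1, 33, 5, 16, 1, 1, 1, 21, 1], [18],
   [26, 1, 37, 10, 17, 11], [17, 65, 1, 3, 15, 1, 18, 2, 20, 4, 21, 1], [26, 1, 37, 2, 17, 9],
   [21, 2, 15, 1, 18, 2, 1, 3, 30, 1, 17, 193], [21, 1, 33, 7, 37, 2],
   [21, 1, 18, 1, 25, 2, 20, 1], [1, 1, 37, 3, 33, 12, 16, 1, 21, 1], [33, 2, 37, 1], [19], [11],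
   [11], [11], [21, 1, 33, 5, 37, 1], [19], [33], [37], [19], [19],
   [16, 1, 33, 2, 1, 1, 21, 1, 37, 1], [16, 1, 33, 2, 1, 1, 21, 1, 37, 1],
   [21, 2, 16, 1, 33, 18, 37, 4, 1, 1], [19], [19], [19], [1, 1, 37, 3, 33, 11, 16, 1, 21, 1],
   [11]],
  [[1], [35], [21, 1, 15, 1, 18, 1, 1, 1, 16, 1], [18, 1, 30, 1, 21, 1, 15, 1, 16, 1],
   [15, 1, 30, 1, 21, 1, 18, 1], [21, 1, 15, 1, 30, 1, 18, 1], [21, 1, 15, 1, 18, 1], [11],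
   [30, 2, 14, 2, 38, 1, 18, 4], [30], [30], [30, 1, 38, 1, 18, 2], [14, 2, 34, 1, 18, 3],
   [12, 1, 11, 3, 32, 1], [35, 1, 18, 1, 36, 6], [11], [36, 32, 11, 1, 35, 5, 18, 1],
   [11, 2, 32, 1, 38, 10, 18, 5, 26, 4], [26, 3, 30, 2, 18, 3, 21, 2],
   [30, 1, 11, 1, 38, 4, 18, 3, 26, 1], [35, 3, 11, 1, 38, 6, 18, 2, 26, 2],
   [30, 1, 11, 1, 32, 2, 38, 3, 18, 4], [21, 2, 15, 1, 18, 1, 1, 3, 16, 1],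
   [17, 1, 18, 1, 1, 2, 21, 2, 15, 1, 30, 1], [21, 1, 1, 1], [18, 2, 11, 1, 38, 5, 26, 2],
   [21, 2, 30, 2, 18, 1], [11], [26, 3, 30, 2, 18, 3, 21, 1], [21, 3, 16, 1, 30, 1, 37, 1],
   [31, 2, 14, 1, 11, 5, 30, 1, 18, 5], [14, 1, 38, 1, 18, 2, 31, 1],
   [30, 1, 14, 1, 38, 1, 18, 2], [30, 1, 11, 1, 32, 1, 38, 6, 18, 4, 26, 3],
   [16, 1, 18, 1, 21, 1, 30, 1, 11, 2, 37, 1], [30, 1, 18, 1], [26, 1, 30, 2, 18, 2, 21, 1],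
   [30, 1, 11, 1, 38, 5, 18, 4, 26, 1], [30, 1, 18, 3, 21, 1]]]

theorem forallZip_certificates :
    forallZip (fun a row => forallZip (checkCertificate a) polytopePoints row) polytopePoints
      certificates = true := by
  decide +kernel

theorem InPolytope.mul {v w : Vec ℝ} (hv : InPolytope v) (hw : InPolytope w) :
    InPolytope (v.mul w) := by
  refine ⟨?_, fun y hy => ?_⟩
  · obtain ⟨⟨a1, a2, a3, a4, a5, a6⟩, -⟩ := hv
    obtain ⟨⟨b1, b2, b3, b4, b5, b6⟩, -⟩ := hw
    refine ⟨?_, ?_, ?_, ?_, ?_, ?_⟩ <;> simp only [Vec.mul] <;> positivity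
  · rw [← Vec.dot_pullLeft]
    refine hv.2 _ ⟨hy.1.pullLeft hw.1, fun a ha => ?_⟩
    rw [Vec.dot_pullLeft, ← Vec.dot_pullRight]
    refine hw.2 _ ⟨hy.1.pullRight (pointVal_nonneg a), fun b hb => ?_⟩
    rw [Vec.dot_pullRight]
    obtain ⟨row, hrow⟩ := exists_of_forallZip forallZip_certificates a ha
    obtain ⟨c, hc⟩ := exists_of_forallZip hrow b hb
    exact dot_mul_le_of_checkCertificate hc hy

theorem inPolytope_single : InPolytope ((Vec.single : Vec ℝ).smul (1 / lam)) := by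
  have hl := lam_pos
  refine ⟨?_, fun y hy => ?_⟩
  · simp only [Vec.Nonneg, Vec.smul, Vec.single]
    refine ⟨?_, ?_, ?_, ?_, ?_, ?_⟩ <;> positivity
  · have h := hy.2 (1, ⟨0, 20000, 0, 0, 0, 20000⟩) List.mem_cons_self
    convert h using 2
    ext <;> simp [Vec.smul, Vec.single, pointVal, Vec.toReal]

theorem InPolytope.total_le {v : Vec ℝ} (hv : InPolytope v) : v.total ≤ 2 / lam ^ 2 := by
  have hl := lam_pos
  have hc : 0 ≤ lam ^ 2 / 2 := by positivity
  have key : ∀ q ∈ polytopePoints,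
      q.2.total * (95 * 10 ^ 15) ≤ 2 * 20000 * lamPowLower (q.1 + 11) := by decide +kernel
  have h := hv.2 ⟨lam ^ 2 / 2, lam ^ 2 / 2, 0, lam ^ 2 / 2, lam ^ 2 / 2, 0⟩
    ⟨⟨le_rfl, hc, le_rfl, le_rfl, hc, le_rfl⟩, fun q hq => ?_⟩
  · rw [le_div_iff₀ (by positivity)]
    simp only [Vec.dot, Vec.total] at h ⊢
    linarith
  · have h1 : (q.2.total * (95 * 10 ^ 15) : ℝ) ≤ 2 * 20000 * lamPowLower (q.1 + 11) := by
      exact_mod_cast key q hq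
    have h2 := lamPowLower_le (q.1 + 11)
    have h3 : lam ^ (q.1 + 11) * lam ^ 2 = 95 * lam ^ q.1 := by
      rw [← lam_pow_thirteen, ← pow_add, ← pow_add]
      congr 1
      omega
    have h4 : (q.2.total * (95 * 10 ^ 15) : ℝ) * lam ^ 2 ≤
        2 * 20000 * (10 ^ 15 * (95 * lam ^ q.1)) := by
      rw [← h3]
      calc _ ≤ (2 * 20000 * (10 ^ 15 * lam ^ (q.1 + 11))) * lam ^ 2 :=
          mul_le_mul_of_nonneg_right (by linarith) (by positivity)
        _ = _ := by ring
    have h5 : (q.2.total : ℝ) * lam ^ 2 ≤ 2 * 20000 * lam ^ q.1 := by linarith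
    rw [pointVal, Vec.dot_smul, div_mul_eq_mul_div, one_mul, div_le_one (by positivity)]
    simp only [Vec.total, Nat.cast_add] at h5
    simp only [Vec.dot, Vec.toReal]
    linarith

end MDS

namespace MDS

open SimpleGraph

/-! ### Decomposition of trees -/

theorem isTree_attachGraph {A B : Type*} [Finite A] [Finite B] {GA : SimpleGraph A}
    {GB : SimpleGraph B} (hA : GA.IsTree) (hB : GB.IsTree) (r : A) (s : B) :
    (attachGraph GA r GB s).IsTree := by
  rw [isTree_iff_connected_and_card]
  refine ⟨hA.connected.sum_sup_edge hB.connected, ?_⟩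
  have h1 := (isTree_iff_connected_and_card.1 hA).2
  have h2 := (isTree_iff_connected_and_card.1 hB).2
  have h3 : Nat.card (GA ⊕g GB).edgeSet = Nat.card GA.edgeSet + Nat.card GB.edgeSet := by
    rw [Nat.card_congr edgeSetSumEquiv, Nat.card_sum]
  have h4 : (attachGraph GA r GB s).edgeSet = insert s(.inl r, .inr s) (GA ⊕g GB).edgeSet := by
    rw [attachGraph, edgeSet_sup, edgeSet_edge, Set.union_comm, Set.insert_eq]
    congr 1
    ext e
    simp only [Set.mem_sdiff, Set.mem_singleton_iff, and_iff_left_iff_imp]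
    rintro rfl
    simp
  have h5 : s(.inl r, .inr s) ∉ (GA ⊕g GB).edgeSet := by simp
  rw [h4, Nat.card_coe_set_eq, Set.ncard_insert_of_notMem h5, ← Nat.card_coe_set_eq, h3,
    Nat.card_sum]
  omega

section Split

variable {V : Type*} {T : SimpleGraph V} {r s : V}

/-- The vertices on the side of `r` when the edge between `r` and `s` is removed. -/
def side (T : SimpleGraph V) (r s : V) : Set V := {v | (T.deleteEdges {s(r, s)}).Reachable r v}

theorem mem_side_self : r ∈ side T r s := Reachable.refl r

theorem side_comm : side T s r = {v | (T.deleteEdges {s(r, s)}).Reachable s v} := by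
  rw [side, Sym2.eq_swap]

theorem connected_induce_side : (T.induce (side T r s)).Connected := by
  have h := ((T.deleteEdges {s(r, s)}).connectedComponentMk r).connected_toSimpleGraph
  have hs : side T r s = ((T.deleteEdges {s(r, s)}).connectedComponentMk r).supp := by
    ext v
    rw [ConnectedComponent.mem_supp_iff, ConnectedComponent.eq]
    exact ⟨Reachable.symm, Reachable.symm⟩
  rw [hs]
  exact h.mono (comap_monotone _ (deleteEdges_le _))

theorem isTree_induce_side (hT : T.IsAcyclic) : (T.induce (side T r s)).IsTree :=
  ⟨connected_induce_side, hT.induce _⟩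

theorem compl_side (hT : T.IsTree) (h : T.Adj r s) : (side T r s)ᶜ = side T s r := by
  have hb : ¬ (T.deleteEdges {s(r, s)}).Reachable r s :=
    isBridge_iff.1 (isAcyclic_iff_forall_adj_isBridge.1 hT.isAcyclic h)
  have key : ∀ {u v : V}, T.Walk u v → u = r →
      (T.deleteEdges {s(r, s)}).Reachable r v ∨ (T.deleteEdges {s(r, s)}).Reachable s v := by
    intro u v p
    induction p using Walk.concatRec with
    | Hnil => rintro rfl; exact .inl (Reachable.refl _)
    | Hconcat p hadj ih =>
      rename_i u v w
      intro hu
      by_cases he : s(v, w) = s(r, s)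
      · rcases Sym2.eq_iff.1 he with ⟨-, rfl⟩ | ⟨-, rfl⟩
        · exact .inr (Reachable.refl _)
        · exact .inl (Reachable.refl _)
      · have hF : (T.deleteEdges {s(r, s)}).Adj v w := by simp [deleteEdges_adj, hadj, he]
        exact (ih hu).imp (·.trans hF.reachable) (·.trans hF.reachable)
  rw [side_comm (r := r) (s := s)]
  ext v
  constructor
  · intro hv
    obtain ⟨p⟩ := hT.connected.preconnected r v
    exact (key p rfl).resolve_left hv
  · exact fun hv hv' => hb (hv'.trans hv.symm)

theorem eq_of_adj_side (h : T.Adj r s) {a b : V} (ha : a ∈ side T r s)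
    (hb : b ∉ side T r s) : T.Adj a b ↔ a = r ∧ b = s := by
  refine ⟨fun hab => ?_, ?_⟩
  · by_cases he : s(a, b) = s(r, s)
    · rcases Sym2.eq_iff.1 he with h' | ⟨-, rfl⟩
      · exact h'
      · exact (hb mem_side_self).elim
    · have hF : (T.deleteEdges {s(r, s)}).Adj a b := by simp [deleteEdges_adj, hab, he]
      exact (hb (Reachable.trans ha hF.reachable)).elim
  · rintro ⟨rfl, rfl⟩
    exact h

open Classical in
/-- A tree is the result of joining the two parts into which an edge splits it. -/
noncomputable def splitIso (h : T.Adj r s) (hs : s ∈ (side T r s)ᶜ) :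
    attachGraph (T.induce (side T r s)) ⟨r, mem_side_self⟩ (T.induce (side T r s)ᶜ) ⟨s, hs⟩ ≃g T where
  toEquiv := Equiv.Set.sumCompl (side T r s)
  map_rel_iff' := by
    rintro (⟨a, ha⟩ | ⟨a, ha⟩) (⟨b, hb⟩ | ⟨b, hb⟩)
    · simp
    · simp [eq_of_adj_side h ha hb]
    · rw [adj_comm]
      simp [eq_of_adj_side h hb ha]
    · simp

end Split

theorem inPolytope_counts (n : ℕ) : ∀ {V : Type*} [Finite V] {T : SimpleGraph V}, T.IsTree →
    ∀ r : V, Nat.card V = n → InPolytope ((counts T r).toReal.smul (1 / lam ^ n)) := by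
  classical
  induction n using Nat.strong_induction_on with
  | _ n ih =>
    intro V _ T hT r hn
    rcases subsingleton_or_nontrivial V with hV | hV
    · have h1 : n = 1 := by
        rw [← hn]
        have : Nonempty V := ⟨r⟩
        exact Nat.card_eq_one_iff_unique.2 ⟨hV, this⟩
      subst h1
      convert inPolytope_single using 2
      · rw [pow_one]
      · rw [counts_of_subsingleton]
        ext <;> simp [Vec.toReal, Vec.single]
    · obtain ⟨s, h⟩ := hT.connected.preconnected.exists_adj_of_nontrivial r
      have hs : s ∈ (side T r s)ᶜ := by
        rw [compl_side hT h]
        exact mem_side_self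
      have hcard : Nat.card (side T r s) + Nat.card ↥(side T r s)ᶜ = n := by
        rw [← hn, ← Nat.card_sum]
        exact Nat.card_congr (Equiv.Set.sumCompl _)
      have : Nonempty (side T r s) := ⟨⟨r, mem_side_self⟩⟩
      have : Nonempty ↥(side T r s)ᶜ := ⟨⟨s, hs⟩⟩
      have hpos := Nat.card_pos (α := side T r s)
      have hpos' := Nat.card_pos (α := ↥(side T r s)ᶜ)
      have h1 := ih _ (by omega) (isTree_induce_side hT.isAcyclic (r := r) (s := s))
        ⟨r, mem_side_self⟩ rfl
      have htree : (T.induce (side T r s)ᶜ).IsTree := by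
        rw [compl_side hT h]
        exact isTree_induce_side hT.isAcyclic
      have h2 := ih _ (by omega) htree ⟨s, hs⟩ rfl
      have h3 := h1.mul h2
      rw [Vec.smul_mul_smul, ← Vec.toReal_mul, ← counts_attachGraph, div_mul_div_comm, one_mul,
        ← pow_add, hcard, ← counts_iso _ (splitIso h hs)] at h3
      exact h3

theorem numMDS_le {V : Type*} [Finite V] {T : SimpleGraph V} (hT : T.IsTree) :
    (numMDS T : ℝ) ≤ 2 * lam ^ ((Nat.card V : ℤ) - 2) := by
  have hl := lam_pos
  obtain ⟨r⟩ := hT.connected.nonempty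
  have h := (inPolytope_counts _ hT r rfl).total_le
  rw [numMDS_eq_total T r]
  have h1 : ((counts T r).total : ℝ) / lam ^ Nat.card V ≤ 2 / lam ^ 2 := by
    refine le_of_eq_of_le ?_ h
    simp only [Vec.total, Vec.smul, Vec.toReal]
    push_cast
    ring
  rw [div_le_iff₀ (by positivity)] at h1
  rw [zpow_sub₀ hl.ne', zpow_natCast]
  calc _ ≤ _ := h1
    _ = _ := by
      rw [show (lam ^ (2 : ℤ)) = lam ^ 2 from zpow_ofNat _ _]
      ring

end MDS

namespace MDS

open SimpleGraph

/-! ### Lower bounds -/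

section Realizes

/-- There is a rooted tree with `n` vertices and the vector `v`. -/
def Realizes (n : ℕ) (v : Vec ℕ) : Prop :=
  ∃ (T : SimpleGraph (Fin n)) (r : Fin n), T.IsTree ∧ counts T r = v

theorem realizes_counts {V : Type*} [Finite V] {T : SimpleGraph V} (hT : T.IsTree) (r : V) :
    Realizes (Nat.card V) (counts T r) := by
  let e := Finite.equivFin V
  exact ⟨T.map e, e r, (Iso.map e T).isTree_iff.1 hT, counts_iso r (Iso.map e T)⟩

theorem realizes_single : Realizes 1 Vec.single :=
  ⟨⊥, 0, .of_subsingleton, counts_of_subsingleton _ _⟩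

theorem Realizes.mul {m n : ℕ} {v w : Vec ℕ} (hv : Realizes m v) (hw : Realizes n w) :
    Realizes (m + n) (v.mul w) := by
  obtain ⟨T, r, hT, rfl⟩ := hv
  obtain ⟨T', r', hT', rfl⟩ := hw
  have h := realizes_counts (isTree_attachGraph hT hT' r r') (.inl r)
  rwa [counts_attachGraph, Nat.card_sum, Nat.card_fin, Nat.card_fin] at h

theorem Realizes.exists_isTree {n : ℕ} {v : Vec ℕ} (h : Realizes n v) :
    ∃ T : SimpleGraph (Fin n), T.IsTree ∧ numMDS T = v.total := by
  obtain ⟨T, r, hT, rfl⟩ := h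
  exact ⟨T, hT, numMDS_eq_total T r⟩

/-- The number of sets for which the root belongs to the set is at least `x`; moreover, states
that contain the root without making it good are outnumbered by those that do not contain it. -/
structure Vec.HasRootBound (v : Vec ℕ) (x : ℕ) : Prop where
  le_sum : x ≤ v.g + v.s + v.l
  l_le_d : v.l ≤ v.d
  s_le_f : v.s ≤ v.f

theorem Vec.HasRootBound.le_total {v : Vec ℕ} {x : ℕ} (h : v.HasRootBound x) : x ≤ v.total := by
  have h1 := h.le_sum
  have h2 := h.l_le_d
  rw [Vec.total]
  omega

theorem hasRootBound_single : (Vec.single : Vec ℕ).HasRootBound 1 :=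
  ⟨le_rfl, le_rfl, le_rfl⟩

theorem Vec.HasRootBound.mul {v w : Vec ℕ} {x y : ℕ} (h : v.HasRootBound x)
    (hy : y ≤ w.g + w.d + w.f) : (v.mul w).HasRootBound (x * y) := by
  obtain ⟨h1, h2, h3⟩ := h
  refine ⟨?_, ?_, ?_⟩
  · calc x * y ≤ (v.g + v.s + v.l) * (w.g + w.d + w.f) := Nat.mul_le_mul h1 hy
      _ = _ := by simp only [Vec.mul]; ring
  · calc v.s * w.g + v.l * (w.g + w.d)
        ≤ v.f * (w.g + w.s) + v.d * (w.g + w.s + w.d + w.p) :=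
          add_le_add (Nat.mul_le_mul h3 (Nat.le_add_right _ _)) (Nat.mul_le_mul h2 (by omega))
      _ = _ := by simp only [Vec.mul]; ring
  · exact Nat.mul_le_mul h3 (Nat.le_add_right _ _)

/-- There is a rooted tree with `n` vertices and the root bound `x`. -/
def RealizesBound (n x : ℕ) : Prop := ∃ v, Realizes n v ∧ v.HasRootBound x

theorem realizesBound_one : RealizesBound 1 1 := ⟨_, realizes_single, hasRootBound_single⟩

theorem RealizesBound.mul {n x m : ℕ} {w : Vec ℕ} (h : RealizesBound n x) (hw : Realizes m w) :
    RealizesBound (n + m) (x * (w.g + w.d + w.f)) := by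
  obtain ⟨v, hv, hx⟩ := h
  exact ⟨_, hv.mul hw, hx.mul le_rfl⟩

theorem RealizesBound.mul_pow {n x m : ℕ} {w : Vec ℕ} (h : RealizesBound n x) (hw : Realizes m w) :
    ∀ k, RealizesBound (n + m * k) (x * (w.g + w.d + w.f) ^ k)
  | 0 => by simpa using h
  | k + 1 => by
    have := (h.mul_pow hw k).mul hw
    rwa [add_assoc, mul_assoc, ← pow_succ, ← Nat.mul_succ] at this

theorem RealizesBound.exists_isTree {n x : ℕ} (h : RealizesBound n x) :
    ∃ T : SimpleGraph (Fin n), T.IsTree ∧ x ≤ numMDS T := by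
  obtain ⟨v, hv, hx⟩ := h
  obtain ⟨T, hT, h⟩ := hv.exists_isTree
  exact ⟨T, hT, h ▸ hx.le_total⟩

theorem realizes_edge : Realizes 2 ⟨1, 0, 0, 1, 0, 0⟩ := realizes_single.mul realizes_single

/-- The rooted tree in which `k` paths with two edges are attached to the root. -/
theorem realizes_spider : ∀ k, Realizes (1 + 2 * k) ⟨0, 1, 2 ^ k - 1, 2 ^ k - 1, 0, 1⟩
  | 0 => realizes_single
  | k + 1 => by
    convert! (realizes_spider k).mul realizes_edge using 1
    have := Nat.one_le_two_pow (n := k)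
    ext <;> simp [Vec.mul, pow_succ] <;> omega

/-- The spider with `k + 1` legs, rooted at a leaf. -/
theorem realizes_spider_leaf (k : ℕ) :
    Realizes (3 + 2 * k) ⟨2 ^ k - 1, 1, 1, 2 ^ k, 0, 2 ^ k⟩ := by
  convert realizes_single.mul (realizes_single.mul (realizes_spider k)) using 1
  · ring
  · have := Nat.one_le_two_pow (n := k)
    ext <;> simp [Vec.mul, Vec.single] <;> omega

theorem realizesBound (j a c : ℕ) :
    RealizesBound (1 + 2 * j + 11 * a + 13 * c) (2 ^ j * 47 ^ a * 95 ^ c) := by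
  have h := ((realizesBound_one.mul_pow realizes_edge j).mul_pow (realizes_spider_leaf 4) a).mul_pow
    (realizes_spider_leaf 5) c
  norm_num at h
  exact h

end Realizes

/-! ### Stars of snowflakes -/

section Snowflake

instance {A B : Type*} [DecidableEq A] [DecidableEq B] (GA : SimpleGraph A) (r : A)
    (GB : SimpleGraph B) (s : B) [DecidableRel GA.Adj] [DecidableRel GB.Adj] :
    DecidableRel (attachGraph GA r GB s).Adj
  | .inl _, .inl _ => decidable_of_iff _ attachGraph_adj_inl_inl.symm
  | .inl _, .inr _ => decidable_of_iff _ attachGraph_adj_inl_inr.symm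
  | .inr _, .inl _ => decidable_of_iff _ attachGraph_adj_inr_inl.symm
  | .inr _, .inr _ => decidable_of_iff _ attachGraph_adj_inr_inr.symm

instance : DecidableRel snowflake.Adj := fun u v => by
  unfold snowflake
  rw [fromRel_adj]
  infer_instance

/-- The graph with one vertex. -/
abbrev dotGraph : SimpleGraph Unit := ⊥

/-- The graph with two vertices and an edge. -/
abbrev edgeGraph : SimpleGraph (Unit ⊕ Unit) := attachGraph dotGraph () dotGraph ()

/-- The graph `GA` with a path with two edges attached to `r`. -/
abbrev addArm {A : Type} (GA : SimpleGraph A) (r : A) : SimpleGraph (A ⊕ (Unit ⊕ Unit)) :=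
  attachGraph GA r edgeGraph (.inl ())

/-- Five paths with two edges, attached to a common vertex. -/
abbrev fiveArms : SimpleGraph (((((Unit ⊕ (Unit ⊕ Unit)) ⊕ (Unit ⊕ Unit)) ⊕ (Unit ⊕ Unit)) ⊕
    (Unit ⊕ Unit)) ⊕ (Unit ⊕ Unit)) :=
  addArm (addArm (addArm (addArm (addArm dotGraph ()) (.inl ())) (.inl (.inl ())))
    (.inl (.inl (.inl ())))) (.inl (.inl (.inl (.inl ()))))

/-- The snowflake, built up from a leaf as the root. -/
abbrev flakeModel : SimpleGraph (Unit ⊕ (Unit ⊕ (((((Unit ⊕ (Unit ⊕ Unit)) ⊕ (Unit ⊕ Unit)) ⊕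
    (Unit ⊕ Unit)) ⊕ (Unit ⊕ Unit)) ⊕ (Unit ⊕ Unit)))) :=
  attachGraph dotGraph () (attachGraph dotGraph () fiveArms (.inl (.inl (.inl (.inl (.inl ()))))))
    (.inl ())

/-- The vertices of an arm of the snowflake. -/
def armVertex (j : Fin 6) (x : Unit ⊕ Unit) : FlakeVertex := some (j, x.isRight)

/-- The identification of the vertices of `flakeModel` with those of the snowflake. -/
def flakeMap : Unit ⊕ (Unit ⊕ (((((Unit ⊕ (Unit ⊕ Unit)) ⊕ (Unit ⊕ Unit)) ⊕ (Unit ⊕ Unit)) ⊕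
    (Unit ⊕ Unit)) ⊕ (Unit ⊕ Unit))) → FlakeVertex
  | .inl _ => some (0, true)
  | .inr (.inl _) => some (0, false)
  | .inr (.inr (.inl (.inl (.inl (.inl (.inl _)))))) => none
  | .inr (.inr (.inl (.inl (.inl (.inl (.inr x)))))) => armVertex 1 x
  | .inr (.inr (.inl (.inl (.inl (.inr x))))) => armVertex 2 x
  | .inr (.inr (.inl (.inl (.inr x)))) => armVertex 3 x
  | .inr (.inr (.inl (.inr x))) => armVertex 4 x
  | .inr (.inr (.inr x)) => armVertex 5 x

set_option synthInstance.maxSize 100000 in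
set_option synthInstance.maxHeartbeats 200000 in
instance : DecidableRel flakeModel.Adj := inferInstance

theorem flakeMap_bijective : Function.Bijective flakeMap := by
  decide +kernel

theorem flakeMap_adj : ∀ x y, snowflake.Adj (flakeMap x) (flakeMap y) ↔ flakeModel.Adj x y := by
  decide +kernel

/-- The snowflake is isomorphic to its model. -/
noncomputable def flakeIso : flakeModel ≃g snowflake where
  toEquiv := Equiv.ofBijective flakeMap flakeMap_bijective
  map_rel_iff' := flakeMap_adj _ _

theorem isTree_snowflake : snowflake.IsTree := by
  have hdot : dotGraph.IsTree := .of_subsingleton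
  have hedge : edgeGraph.IsTree := isTree_attachGraph hdot hdot _ _
  have h {A : Type} [Finite A] {G : SimpleGraph A} (hG : G.IsTree) (r : A) : (addArm G r).IsTree :=
    isTree_attachGraph hG hedge _ _
  rw [← flakeIso.isTree_iff]
  exact isTree_attachGraph hdot (isTree_attachGraph hdot (h (h (h (h (h hdot _) _) _) _) _) _ _) _ _

theorem counts_snowflake : counts snowflake (some (0, true)) = ⟨31, 1, 1, 32, 0, 32⟩ := by
  have h : flakeIso (.inl ()) = some (0, true) := rfl
  have hdot : counts dotGraph () = Vec.single := counts_of_subsingleton _ _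
  rw [← h, counts_iso]
  simp only [counts_attachGraph, hdot]
  rfl

end Snowflake

section Star

variable {k : ℕ}

theorem starOfSnowflakes_adj_none_some {i : Fin k} {u : FlakeVertex} :
    (starOfSnowflakes k).Adj none (some (i, u)) ↔ u = some (0, true) := by
  simp [starOfSnowflakes, fromRel_adj]

theorem starOfSnowflakes_adj_some_some {i j : Fin k} {u v : FlakeVertex} :
    (starOfSnowflakes k).Adj (some (i, u)) (some (j, v)) ↔ i = j ∧ snowflake.Adj u v := by
  simp only [starOfSnowflakes, fromRel_adj]
  constructor
  · rintro ⟨-, (⟨_, h, -⟩ | ⟨a, b, c, h1, h2, h3⟩) | (⟨_, h, -⟩ | ⟨a, b, c, h1, h2, h3⟩)⟩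
    · simp at h
    · simp only [Option.some.injEq, Prod.mk.injEq] at h1 h2
      obtain ⟨⟨rfl, rfl⟩, rfl, rfl⟩ := h1, h2
      exact ⟨rfl, h3⟩
    · simp at h
    · simp only [Option.some.injEq, Prod.mk.injEq] at h1 h2
      obtain ⟨⟨rfl, rfl⟩, rfl, rfl⟩ := h1, h2
      exact ⟨rfl, h3.symm⟩
  · rintro ⟨rfl, h⟩
    refine ⟨fun he => ?_, .inl (.inr ⟨i, u, v, rfl, rfl, h⟩)⟩
    simp only [Option.some.injEq, Prod.mk.injEq, true_and] at he
    exact h.ne he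

/-- The vertices of a star of snowflakes and one more snowflake. -/
def starMap (k : ℕ) : Option (Fin k × FlakeVertex) ⊕ FlakeVertex → Option (Fin (k + 1) × FlakeVertex)
  | .inl none => none
  | .inl (some (i, u)) => some (i.castSucc, u)
  | .inr u => some (Fin.last k, u)

theorem starMap_bijective : Function.Bijective (starMap k) := by
  constructor
  · rintro ((- | ⟨i, u⟩) | u) ((- | ⟨j, v⟩) | v) h <;>
      simp_all [starMap, Fin.castSucc_ne_last, (Fin.castSucc_ne_last _).symm]
  · rintro (- | ⟨i, u⟩)
    · exact ⟨.inl none, rfl⟩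
    · induction i using Fin.lastCases with
      | last => exact ⟨.inr u, rfl⟩
      | cast i => exact ⟨.inl (some (i, u)), rfl⟩

/-- The star of `k + 1` snowflakes arises from that of `k` snowflakes by attaching a snowflake. -/
noncomputable def starIso (k : ℕ) :
    attachGraph (starOfSnowflakes k) none snowflake (some (0, true)) ≃g starOfSnowflakes (k + 1) where
  toEquiv := Equiv.ofBijective (starMap k) starMap_bijective
  map_rel_iff' := by
    have h1 {i : Fin k} : Fin.last k ≠ i.castSucc := (Fin.castSucc_ne_last i).symm
    have h2 {i : Fin k} : i.castSucc ≠ Fin.last k := Fin.castSucc_ne_last i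
    have h3 {k : ℕ} {i : Fin k} {u : FlakeVertex} :
        (starOfSnowflakes k).Adj (some (i, u)) none ↔ u = some (0, true) := by
      rw [adj_comm, starOfSnowflakes_adj_none_some]
    rintro ((- | ⟨i, u⟩) | u) ((- | ⟨j, v⟩) | v) <;>
      simp [starMap, starOfSnowflakes_adj_none_some, starOfSnowflakes_adj_some_some, h1, h2, h3]

theorem isTree_starOfSnowflakes : ∀ k, (starOfSnowflakes k).IsTree
  | 0 => .of_subsingleton
  | k + 1 => (starIso k).isTree_iff.1
      (isTree_attachGraph (isTree_starOfSnowflakes k) isTree_snowflake _ _)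

theorem hasRootBound_starOfSnowflakes :
    ∀ k, (counts (starOfSnowflakes k) none).HasRootBound (95 ^ k)
  | 0 => by
    rw [counts_of_subsingleton]
    exact hasRootBound_single
  | k + 1 => by
    have h := counts_iso (.inl none) (starIso k)
    have h' : starIso k (.inl none) = none := rfl
    rw [h', counts_attachGraph, counts_snowflake] at h
    rw [h, pow_succ]
    exact (hasRootBound_starOfSnowflakes k).mul le_rfl

theorem le_numMDS_starOfSnowflakes (k : ℕ) : 95 ^ k ≤ numMDS (starOfSnowflakes k) := by
  rw [numMDS_eq_total _ none]
  exact (hasRootBound_starOfSnowflakes k).le_total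

theorem card_star (k : ℕ) : Nat.card (Option (Fin k × FlakeVertex)) = 13 * k + 1 := by
  rw [Nat.card_eq_fintype_card, Fintype.card_option, Fintype.card_prod, Fintype.card_fin,
    mul_comm]
  rfl

end Star

end MDS

namespace MDS

/-! ### Numerical bounds -/

theorem mul_lam_pow_le {c : ℝ} {N : ℝ} {e : ℕ} (hN : 0 ≤ N) (h : c ^ 13 * 95 ^ e ≤ N ^ 13) :
    c * lam ^ e ≤ N := by
  refine le_of_pow_le_pow_left₀ (n := 13) (by norm_num) hN ?_
  rwa [mul_pow, ← pow_mul, mul_comm e, pow_mul, lam_pow_thirteen]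

theorem mul_lam_pow_lt {c : ℝ} {N : ℝ} {e : ℕ} (hN : 0 ≤ N) (h : c ^ 13 * 95 ^ e < N ^ 13) :
    c * lam ^ e < N := by
  refine lt_of_pow_lt_pow_left₀ 13 hN ?_
  rwa [mul_pow, ← pow_mul, mul_comm e, pow_mul, lam_pow_thirteen]

theorem abs_lam_sub_lt : |lam - 1.4194908| < 0.00000005 := by
  rw [abs_sub_lt_iff]
  constructor
  · have : 1 * lam ^ 1 < 1.41949085 := mul_lam_pow_lt (by norm_num) (by norm_num)
    linarith
  · have : (1.41949075 : ℝ) < lam := by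
      refine lt_of_pow_lt_pow_left₀ 13 lam_pos.le ?_
      rw [lam_pow_thirteen]
      norm_num
    linarith

theorem two_mul_lam_zpow_lt (n : ℕ) : 2 * lam ^ ((n : ℤ) - 2) < 0.992579 * lam ^ n := by
  have hl := lam_pos
  have h : (2 / 0.992579 : ℝ) < lam ^ 2 := by
    refine lt_of_pow_lt_pow_left₀ 13 (by positivity) ?_
    rw [← pow_mul, mul_comm, pow_mul, lam_pow_thirteen]
    norm_num
  rw [div_lt_iff₀ (by norm_num)] at h
  rw [zpow_sub₀ hl.ne', zpow_natCast, show lam ^ (2 : ℤ) = lam ^ 2 from zpow_ofNat _ _,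
    mul_div_assoc', div_lt_iff₀ (by positivity)]
  have hn : 0 < lam ^ n := by positivity
  nlinarith

theorem mul_lam_pow_lt_pow (k : ℕ) : 0.704477 * lam ^ (13 * k + 1) < (95 : ℝ) ^ k := by
  have h : (0.704477 : ℝ) * lam ^ 1 < 1 := mul_lam_pow_lt (by norm_num) (by norm_num)
  rw [pow_add, pow_mul, lam_pow_thirteen]
  have : (0 : ℝ) < 95 ^ k := by positivity
  nlinarith

theorem exists_isTree_of_factors {n : ℕ} (j a c : ℕ) (hn : n = 1 + 2 * j + 11 * a + 13 * c)
    (h : (0.649748 : ℝ) ^ 13 * 95 ^ (1 + 2 * j + 11 * a) ≤ (2 ^ j * 47 ^ a) ^ 13) :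
    ∃ T : SimpleGraph (Fin n), T.IsTree ∧ 0.649748 * lam ^ n ≤ (numMDS T : ℝ) := by
  subst hn
  obtain ⟨T, hT, hx⟩ := (realizesBound j a c).exists_isTree
  refine ⟨T, hT, ?_⟩
  have h1 : (0.649748 : ℝ) * lam ^ (1 + 2 * j + 11 * a) ≤ 2 ^ j * 47 ^ a :=
    mul_lam_pow_le (by positivity) h
  have h2 : (2 ^ j * 47 ^ a * 95 ^ c : ℝ) ≤ numMDS T := by exact_mod_cast hx
  rw [pow_add _ _ (13 * c), pow_mul lam 13, lam_pow_thirteen, ← mul_assoc]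
  exact (mul_le_mul_of_nonneg_right h1 (by positivity)).trans h2

theorem exists_isTree_of_realizes {n : ℕ} {v : Vec ℕ} (hv : Realizes n v)
    (h : (0.649748 : ℝ) ^ 13 * 95 ^ n ≤ (v.total : ℝ) ^ 13) :
    ∃ T : SimpleGraph (Fin n), T.IsTree ∧ 0.649748 * lam ^ n ≤ (numMDS T : ℝ) := by
  obtain ⟨T, hT, hx⟩ := hv.exists_isTree
  exact ⟨T, hT, hx ▸ mul_lam_pow_le (Nat.cast_nonneg _) h⟩

theorem exists_isTree_le_numMDS (n : ℕ) (hn : 1 ≤ n) :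
    ∃ T : SimpleGraph (Fin n), T.IsTree ∧ 0.649748 * lam ^ n ≤ (numMDS T : ℝ) := by
  obtain ⟨c, ρ, hρ, hc⟩ : ∃ c ρ, ρ < 13 ∧ n = 1 + ρ + 13 * c :=
    ⟨(n - 1) / 13, (n - 1) % 13, Nat.mod_lt _ (by norm_num), by omega⟩
  have leaf (k : ℕ) := realizes_single.mul (realizes_spider_leaf k)
  obtain rfl | ⟨c', rfl⟩ : c = 0 ∨ ∃ c', c = c' + 1 := by
    cases c
    · exact .inl rfl
    · exact .inr ⟨_, rfl⟩
  · interval_cases ρ <;> subst hc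
    · exact exists_isTree_of_factors 0 0 0 rfl (by norm_num)
    · exact exists_isTree_of_realizes realizes_edge (by norm_num [Vec.total])
    · exact exists_isTree_of_factors 1 0 0 rfl (by norm_num)
    · exact exists_isTree_of_realizes (leaf 0) (by norm_num [Vec.total, Vec.mul, Vec.single])
    · exact exists_isTree_of_factors 2 0 0 rfl (by norm_num)
    · exact exists_isTree_of_realizes (leaf 1) (by norm_num [Vec.total, Vec.mul, Vec.single])
    · exact exists_isTree_of_factors 3 0 0 rfl (by norm_num)
    · exact exists_isTree_of_realizes (leaf 2) (by norm_num [Vec.total, Vec.mul, Vec.single])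
    · exact exists_isTree_of_factors 4 0 0 rfl (by norm_num)
    · exact exists_isTree_of_realizes (leaf 3) (by norm_num [Vec.total, Vec.mul, Vec.single])
    · exact exists_isTree_of_factors 5 0 0 rfl (by norm_num)
    · exact exists_isTree_of_factors 0 1 0 rfl (by norm_num)
    · exact exists_isTree_of_factors 6 0 0 rfl (by norm_num)
  · interval_cases ρ
    · exact exists_isTree_of_factors 0 0 (c' + 1) (by omega) (by norm_num)
    · exact exists_isTree_of_factors 7 0 c' (by omega) (by norm_num)
    · exact exists_isTree_of_factors 1 0 (c' + 1) (by omega) (by norm_num)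
    · exact exists_isTree_of_factors 8 0 c' (by omega) (by norm_num)
    · exact exists_isTree_of_factors 2 0 (c' + 1) (by omega) (by norm_num)
    · exact exists_isTree_of_factors 9 0 c' (by omega) (by norm_num)
    · exact exists_isTree_of_factors 3 0 (c' + 1) (by omega) (by norm_num)
    · exact exists_isTree_of_factors 10 0 c' (by omega) (by norm_num)
    · exact exists_isTree_of_factors 4 0 (c' + 1) (by omega) (by norm_num)
    · exact exists_isTree_of_factors 0 2 c' (by omega) (by norm_num)
    · exact exists_isTree_of_factors 5 0 (c' + 1) (by omega) (by norm_num)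
    · exact exists_isTree_of_factors 0 1 (c' + 1) (by omega) (by norm_num)
    · exact exists_isTree_of_factors 6 0 (c' + 1) (by omega) (by norm_num)

theorem exists_iso_starOfSnowflakes (k : ℕ) :
    ∃ T : SimpleGraph (Fin (13 * k + 1)), T.IsTree ∧ Nonempty (T ≃g starOfSnowflakes k) ∧
      95 ^ k ≤ numMDS T := by
  let e : Option (Fin k × FlakeVertex) ≃ Fin (13 * k + 1) :=
    (Finite.equivFin _).trans (finCongr (card_star k))
  let i := SimpleGraph.Iso.map e (starOfSnowflakes k)
  refine ⟨(starOfSnowflakes k).map e, i.isTree_iff.1 (isTree_starOfSnowflakes k),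
    ⟨i.symm⟩, ?_⟩
  rw [numMDS_iso i]
  exact le_numMDS_starOfSnowflakes k

end MDS

theorem theorem1 :
    -- the numerical value of the growth constant, correct to all digits shown
    |MDS.lam - 1.4194908| < 0.00000005 ∧
    -- the upper bound
    (∀ (V : Type*) [Finite V] (T : SimpleGraph V), T.IsTree →
      (MDS.numMDS T : ℝ) ≤ 2 * MDS.lam ^ ((Nat.card V : ℤ) - 2) ∧
      2 * MDS.lam ^ ((Nat.card V : ℤ) - 2) < 0.992579 * MDS.lam ^ Nat.card V) ∧
    -- the lower bound for every order
    (∀ n : ℕ, 1 ≤ n → ∃ T : SimpleGraph (Fin n), T.IsTree ∧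
      0.649748 * MDS.lam ^ n ≤ (MDS.numMDS T : ℝ)) ∧
    -- the lower bound for orders of the form 13 k + 1
    (∀ n k : ℕ, n = 13 * k + 1 →
      ∃ T : SimpleGraph (Fin n), T.IsTree ∧ Nonempty (T ≃g MDS.starOfSnowflakes k) ∧
        95 ^ k ≤ MDS.numMDS T ∧ 0.704477 * MDS.lam ^ n < (95 : ℝ) ^ k) := by
  refine ⟨MDS.abs_lam_sub_lt, fun V _ T hT => ⟨MDS.numMDS_le hT, MDS.two_mul_lam_zpow_lt _⟩,
    MDS.exists_isTree_le_numMDS, ?_⟩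
  rintro n k rfl
  obtain ⟨T, hT, hiso, hle⟩ := MDS.exists_iso_starOfSnowflakes k
  exact ⟨T, hT, hiso, hle, MDS.mul_lam_pow_lt_pow k⟩
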